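/- Let $G$ be a metric graph, i.e. the compact space obtained from a finite connected graph $(V,E)$ with edge lengths $\ell(e)\in(0,\infty)$ (loops and multiple edges allowed) by gluing intervals $[0,\ell(e)]$ at the vertices. Let $H^1(G)$ be the space of continuous $f:G\to\mathbb R$ that are $H^1$ on each edge, and $q(f,g)=\int_G f'g'\,dx$. A function $f\in H^1(G)$ is harmonic on an open set $O$ if $q(f,g)=0$ for all $g\in H^1(G)$ vanishing on $G\setminus O$. For a Borel probability measure $\mu$ on $G$, let $H^1(G,\mu)$ be the space of $f\in H^1(G)$ that are harmonic on $G\setminus\operatorname{supp}\mu$, viewed as a subspace of $L^2(G,\mu)$, and let $H_\mu$ be the self-adjoint operator in $L^2(G,\mu)$ with $f\in\operatorname{dom}(H_\mu)$, $H_\mu f=g$ if and only if $f\in H^1(G,\mu)$ and $q(f,\varphi)=\int_G g\varphi\,d\mu$ for all $\varphi\in H^1(G,\mu)$. Its eigenvalues, counted with multiplicity, are $0=\lambda_0(H_\mu)<\lambda_1(H_\mu)\le\dots$, with $\lambda_k(H_\mu)=\infty$ for $k\ge\dim L^2(G,\mu)$. Eigenfunctions are understood through their representatives in $H^1(G,\mu)$.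 Put $\lambda_1^{\min}(G)=\min_\mu\lambda_1(H_\mu)$, the minimum over all Borel probability measures on $G$. A closed connected non-empty set $K\subseteq G$ is itself a metric graph, with its own $H^1(K)$ and energy form. For a closed set $A\subseteq K$ and a Borel probability measure $\mu$ on $K$ with $\mu(A)=0$, let $H^D_\mu$ be the operator in $L^2(K,\mu)$ defined in the same way from the space of those $f\in H^1(K)$ that vanish on $A$ and are harmonic on $K\setminus(\operatorname{supp}\mu\cup A)$, and let $\lambda_0(H^D_\mu)$ be its smallest eigenvalue. Put $\lambda_0^{\min,D}(K,A)=\inf_\mu\lambda_0(H_\mu^D)$, the infimum over all such $\mu$ (with $\inf\emptyset=\infty$). A weighted $2$-partition of $G$ is a collection $\mathcal P=\{(G_1,\omega_1),(G_2,\omega_2)\}$ of closed, non-empty, connected subsets $G_1,G_2\subseteq G$ with disjoint interiors and weights $\omega_1,\omega_2>0$ with $\omega_1+\omega_2=1$; the $G_i$ need not cover $G$. Its Dirichlet energy is $$\Lambda(\mathcal P)=\max_{i=1,2}\frac1{\omega_i}\lambda_0^{\min,D}(G_i,\partial G_i),$$ where $\partial G_i$ is the topological boundary of $G_i$ in $G$,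 and $\mathcal L_2(G)=\inf_{\mathcal P}\Lambda(\mathcal P)$ is the infimum over all weighted $2$-partitions of $G$. Theorem. The minimum defining $\lambda_1^{\min}(G)$ is attained, and $$\mathcal L_2(G)=\lambda_1^{\min}(G).$$ Moreover, if $\mu$ is a Borel probability measure on $G$ with $\lambda_1(H_\mu)=\lambda_1^{\min}(G)$, and $f$ is an eigenfunction of $H_\mu$ for the eigenvalue $\lambda_1(H_\mu)$, then the nodal domains $$N^+=\overline{\{x\in G: f(x)>0\}},\qquad N^-=\overline{\{x\in G: f(x)<0\}},$$ together with the weights $\omega_+=\omega_-=\tfrac12$, form a weighted $2$-partition $\mathcal P$ of $G$ with $\Lambda(\mathcal P)=\mathcal L_2(G)$. -/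

import Mathlib

open MeasureTheory
open scoped ENNReal NNReal ContDiff

noncomputable section

/-! ## Weak derivatives on open subsets of the line -/

/-- `g` is a distributional derivative of `u` on the open set `U ⊆ ℝ`. -/
def IsWeakDeriv (U : Set ℝ) (u g : ℝ → ℝ) : Prop :=
  ∀ φ : ℝ → ℝ, ContDiff ℝ ∞ φ → HasCompactSupport φ → tsupport φ ⊆ U →
    ∫ t in U, u t * deriv φ t = -∫ t in U, g t * φ t

/-- `u` belongs to the Sobolev space `H¹(U)`, for an open set `U ⊆ ℝ`. -/
def MemSobolev (U : Set ℝ) (u : ℝ → ℝ) : Prop :=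
  MemLp u 2 (volume.restrict U) ∧ ∃ g : ℝ → ℝ, MemLp g 2 (volume.restrict U) ∧ IsWeakDeriv U u g

open Classical in
/-- The weak derivative in `L²(U)` of a function in `H¹(U)`; it is unique up to null sets,
and the value is `0` when there is none. -/
def weakDeriv (U : Set ℝ) (u : ℝ → ℝ) : ℝ → ℝ :=
  if h : ∃ g : ℝ → ℝ, MemLp g 2 (volume.restrict U) ∧ IsWeakDeriv U u g then h.choose else 0

/-! ## Metric graphs -/

/-- A connected graph on the vertices `V` and edges `E` (loops and multiple edges allowed), with an
orientation of the edges and a positive length for each edge. -/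
structure MetricGraph (V E : Type*) where
  src : E → V
  tgt : E → V
  len : E → ℝ
  len_pos : ∀ e, 0 < len e
  nonempty : Nonempty V
  connected : ∀ u v : V, Relation.EqvGen (fun a b => ∃ e, src e = a ∧ tgt e = b) u v

namespace MetricGraph

variable {V E : Type*}

/-- The vertices together with one closed interval `[0, ℓ(e)]` for each edge `e`. -/
abbrev PrePoint (G : MetricGraph V E) : Type _ := V ⊕ (Σ e : E, Set.Icc (0 : ℝ) (G.len e))

/-- Discrete topology on the vertices, and the usual one on each interval. -/
instance (G : MetricGraph V E) : TopologicalSpace G.PrePoint :=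
  @instTopologicalSpaceSum V (Σ e : E, Set.Icc (0 : ℝ) (G.len e)) ⊥ inferInstance

/-- The left end of an edge is glued to its source and the right end to its target. -/
inductive Glue (G : MetricGraph V E) : G.PrePoint → G.PrePoint → Prop
  | left (e : E) : Glue G (Sum.inr ⟨e, ⟨0, le_rfl, (G.len_pos e).le⟩⟩) (Sum.inl (G.src e))
  | right (e : E) : Glue G (Sum.inr ⟨e, ⟨G.len e, (G.len_pos e).le, le_rfl⟩⟩) (Sum.inl (G.tgt e))

/-- The metric graph as a topological space: the quotient by the gluing relation. -/
def Point (G : MetricGraph V E) : Type _ := Quot G.Glue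

instance (G : MetricGraph V E) : TopologicalSpace G.Point :=
  inferInstanceAs (TopologicalSpace (Quot G.Glue))

instance (G : MetricGraph V E) : MeasurableSpace G.Point := borel G.Point

instance (G : MetricGraph V E) : BorelSpace G.Point := ⟨rfl⟩

/-- The arc length parametrization of the edge `e`, on `[0, ℓ(e)]` (constant outside). -/
def edgeMap (G : MetricGraph V E) (e : E) (t : ℝ) : G.Point :=
  Quot.mk _ (Sum.inr ⟨e, Set.projIcc 0 (G.len e) (G.len_pos e).le t⟩)

/-! ## Sobolev spaces and harmonic functions

Everything is set up for a closed subset `K` of the metric graph. When `K` is connected, it is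
itself a metric graph, whose edges lie in the edges of `G`; the case `K = Set.univ` is `G` itself.
A function on `K` is represented by its extension by `0` to `G`. -/

/-- The open part of the edge `e` that lies in `K`. -/
def edgeDomain (G : MetricGraph V E) (K : Set G.Point) (e : E) : Set ℝ :=
  Set.Ioo 0 (G.len e) ∩ interior (G.edgeMap e ⁻¹' K)

/-- The Sobolev space `H¹(K)`. -/
def H1 (G : MetricGraph V E) (K : Set G.Point) : Set (G.Point → ℝ) :=
  {f | ContinuousOn f K ∧ (∀ x ∉ K, f x = 0) ∧
    ∀ e, MemSobolev (G.edgeDomain K e) (fun t => f (G.edgeMap e t))}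

/-- The space `H¹₀(K, A)` of functions in `H¹(K)` vanishing on the Dirichlet set `A`. -/
def H10 (G : MetricGraph V E) (K A : Set G.Point) : Set (G.Point → ℝ) :=
  {f | f ∈ G.H1 K ∧ ∀ x ∈ A, f x = 0}

/-- The energy form `q(f, g) = ∫ f' g' dx` of the metric graph `K`. -/
def energy [Fintype E] (G : MetricGraph V E) (K : Set G.Point) (f g : G.Point → ℝ) : ℝ :=
  ∑ e, ∫ t in G.edgeDomain K e,
    weakDeriv (G.edgeDomain K e) (fun s => f (G.edgeMap e s)) t *
      weakDeriv (G.edgeDomain K e) (fun s => g (G.edgeMap e s)) t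

/-- `f` is a harmonic function on the relatively open subset `O` of `K`. -/
def IsHarmonicOn [Fintype E] (G : MetricGraph V E) (K O : Set G.Point) (f : G.Point → ℝ) : Prop :=
  ∀ g ∈ G.H1 K, (∀ x ∈ K \ O, g x = 0) → G.energy K f g = 0

/-! ## Laplacians and their eigenvalues -/

/-- The form domain `H¹₀(K, A, μ)`: functions in `H¹₀(K, A)` that are harmonic
on `K \ (supp μ ∪ A)`. -/
def formDomain [Fintype E] (G : MetricGraph V E) (K A : Set G.Point) (μ : Measure G.Point) :
    Set (G.Point → ℝ) :=
  {f | f ∈ G.H10 K A ∧ G.IsHarmonicOn K (K \ (μ.support ∪ A)) f}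

/-- The graph of the Laplacian for `μ` on `K` with Dirichlet condition at `A`: the function `f` is
in the domain of the operator in `L²(K, μ)` given by the energy form on `H¹₀(K, A, μ)`, and the
operator maps `f` to `g`. An element of the form domain stands for its class in `L²(K, μ)`. -/
def IsLaplacian [Fintype E] (G : MetricGraph V E) (K A : Set G.Point) (μ : Measure G.Point)
    (f g : G.Point → ℝ) : Prop :=
  f ∈ G.formDomain K A μ ∧ MemLp g 2 μ ∧
    ∀ φ ∈ G.formDomain K A μ, G.energy K f φ = ∫ x, g x * φ x ∂μ

/-- `f` is an eigenfunction of the Laplacian, with eigenvalue `t`. -/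
def IsEigenfunction [Fintype E] (G : MetricGraph V E) (K A : Set G.Point) (μ : Measure G.Point)
    (t : ℝ) (f : G.Point → ℝ) : Prop :=
  f ≠ 0 ∧ G.IsLaplacian K A μ f (fun x => t * f x)

/-- The `k`-th eigenvalue, `k = 0, 1, 2, …`, counted with multiplicity: the smallest `s` such that
the eigenfunctions with eigenvalue at most `s` span a space of dimension at least `k + 1`, and `∞`
if there are at most `k` eigenvalues. -/
def eigenvalue [Fintype E] (G : MetricGraph V E) (K A : Set G.Point) (μ : Measure G.Point)
    (k : ℕ) : ℝ≥0∞ :=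
  ⨅ (s : ℝ≥0) (_ : (k : Cardinal) + 1 ≤ Module.rank ℝ
      (Submodule.span ℝ {f | ∃ t : ℝ, t ≤ s ∧ G.IsEigenfunction K A μ t f})), (s : ℝ≥0∞)

/-- The first nontrivial eigenvalue `λ₁(H_μ)` of the Laplacian `H_μ` on `G`. -/
def lambda1 [Fintype E] (G : MetricGraph V E) (μ : Measure G.Point) : ℝ≥0∞ :=
  G.eigenvalue Set.univ ∅ μ 1

/-- The first optimal eigenvalue of `G`: the minimal `λ₁(H_μ)` over Borel probability measures. -/
def lambda1Min [Fintype E] (G : MetricGraph V E) : ℝ≥0∞ :=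
  ⨅ (μ : Measure G.Point) (_ : IsProbabilityMeasure μ), G.lambda1 μ

/-- The smallest optimal Dirichlet eigenvalue `λ₀^{min,D}(K, A)`: the infimum of the smallest
Dirichlet eigenvalue over the probability measures on `K` with `μ(A) = 0`. -/
def dirichletMin [Fintype E] (G : MetricGraph V E) (K A : Set G.Point) : ℝ≥0∞ :=
  ⨅ (μ : Measure G.Point) (_ : IsProbabilityMeasure μ ∧ μ Kᶜ = 0 ∧ μ A = 0), G.eigenvalue K A μ 0

/-! ## Weighted partitions -/

/-- A (not necessarily exhaustive) weighted `n`-partition of `G`. -/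
structure WeightedPartition (G : MetricGraph V E) (n : ℕ) where
  piece : Fin n → Set G.Point
  weight : Fin n → ℝ
  isClosed_piece : ∀ i, IsClosed (piece i)
  isConnected_piece : ∀ i, IsConnected (piece i)
  disjoint_interior : ∀ i j, i ≠ j → Disjoint (interior (piece i)) (interior (piece j))
  weight_pos : ∀ i, 0 < weight i
  sum_weight : ∑ i, weight i = 1

/-- The Dirichlet energy `Λ(P)` of a weighted partition. -/
def WeightedPartition.dirichletEnergy [Fintype E] {G : MetricGraph V E} {n : ℕ}
    (P : G.WeightedPartition n) : ℝ≥0∞ :=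
  ⨆ i, ENNReal.ofReal (1 / P.weight i) * G.dirichletMin (P.piece i) (frontier (P.piece i))

/-- The minimal Dirichlet energy `𝓛ₙ(G)` over weighted `n`-partitions. -/
def minDirichletEnergy [Fintype E] (G : MetricGraph V E) (n : ℕ) : ℝ≥0∞ :=
  ⨅ P : G.WeightedPartition n, P.dirichletEnergy

end MetricGraph

end

open Set Filter Topology

noncomputable section

/-! ## Weak derivatives in dimension one -/

/-! Both quantities equal `4 / R`, where `R` is the largest effective resistance between two points:
the least constant with `(g p - g q)² ≤ R * q(g, g)` for all `g` in `H¹(G)` and all `p`, `q`. The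
supremum is attained (`exists_max_resistance`): derivatives of `H¹` functions form a Hilbert space
on which differences of point evaluations are bounded functionals depending norm-continuously on the
two points, and the graph is compact. The Riesz representative of the extremal difference is the
potential `k` of a unit flow from `x` to `y`, and `R = k x - k y`.

Lower bound for the eigenvalue: a nonconstant eigenfunction `f` has mean zero. If `M` and `m` are
its extreme values, integrating `(M - f)(f - m) ≥ 0` gives `∫ f² dμ ≤ -Mm ≤ (M - m)² / 4`. Since
`q(f, f) = t ∫ f² dμ` and `(M - m)² ≤ R q(f, f)`, it follows that `4 ≤ R t` (`extremal_values`).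
Half a unit mass at each of `x` and `y` attains this value, with the centred potential as
eigenfunction (`exists_isEigenfunction_of_potential`).

Lower bound for partitions: Dirichlet eigenfunctions on the two pieces, normalized to have value `1`
at a maximum of their modulus, have disjoint supports up to null sets of energy. Their difference
varies by `2` between two points, so `4` is at most `R` times the sum of the two energies, and the
weights add up to `1` (`le_dirichletEnergy`).

Nodal domains: if the eigenvalue is `4 / R`, all the inequalities above are equalities. Hence `m =
-M`, and `f` is extremal in the resistance inequality, so by first variation it is a multiple of the
potential of a flow from a maximum `p` to a minimum `q` (`exists_flow`). Cut off to its positive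
nodal domain, `f` is a Dirichlet eigenfunction for the point mass at `p` with eigenvalue `2 / R`;
the weight `1/2` doubles this to `4 / R`. A part of the nodal domain separated from `p` would carry
no energy, whence connectedness. The negative domain is treated through `-f`. -/

theorem notMem_tsupport_eq_zero {φ : ℝ → ℝ} {U : Set ℝ} (hs : tsupport φ ⊆ U) {x : ℝ}
    (hx : x ∉ U) : φ x = 0 := image_eq_zero_of_notMem_tsupport fun h => hx (hs h)

theorem notMem_tsupport_deriv_eq_zero {φ : ℝ → ℝ} {U : Set ℝ} (hs : tsupport φ ⊆ U) {x : ℝ}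
    (hx : x ∉ U) : deriv φ x = 0 :=
  image_eq_zero_of_notMem_tsupport fun h => hx (hs (tsupport_deriv_subset h))

theorem setIntegral_mul_testFunction {φ : ℝ → ℝ} {U U' : Set ℝ} (hU : MeasurableSet U)
    (hUU : U' ⊆ U) (hs : ∀ x ∉ U', φ x = 0) (u : ℝ → ℝ) :
    ∫ t in U, u t * φ t = ∫ t in U', u t * φ t :=
  setIntegral_eq_of_subset_of_forall_sdiff_eq_zero hU hUU
    fun x hx => by rw [hs x hx.2, mul_zero]

theorem IsWeakDeriv.mono {U U' : Set ℝ} (hU : MeasurableSet U) {u g : ℝ → ℝ}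
    (h : IsWeakDeriv U u g) (hUU : U' ⊆ U) : IsWeakDeriv U' u g := by
  intro φ hφ hc hs
  have := h φ hφ hc (hs.trans hUU)
  rwa [setIntegral_mul_testFunction hU hUU (fun x hx => notMem_tsupport_deriv_eq_zero hs hx),
    setIntegral_mul_testFunction hU hUU (fun x hx => notMem_tsupport_eq_zero hs hx)] at this

theorem IsWeakDeriv.congr {U : Set ℝ} (hU : MeasurableSet U) {u v g h : ℝ → ℝ}
    (hd : IsWeakDeriv U u g) (huv : EqOn u v U) (hgh : EqOn g h U) : IsWeakDeriv U v h := by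
  intro φ hφ hc hs
  have h1 : ∫ t in U, u t * deriv φ t = ∫ t in U, v t * deriv φ t :=
    setIntegral_congr_fun hU fun t ht => by simp only [huv ht]
  have h2 : ∫ t in U, g t * φ t = ∫ t in U, h t * φ t :=
    setIntegral_congr_fun hU fun t ht => by simp only [hgh ht]
  rw [← h1, ← h2]
  exact hd φ hφ hc hs

theorem MeasureTheory.MemLp.locallyIntegrableOn_two {U : Set ℝ} {g : ℝ → ℝ}
    (hg : MemLp g 2 (volume.restrict U)) : LocallyIntegrableOn g U volume := by
  have hg' : LocallyIntegrable g (volume.restrict U) := hg.locallyIntegrable (by norm_num)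
  exact locallyIntegrableOn_of_locallyIntegrable_restrict hg'

theorem isWeakDeriv_ae_unique {U : Set ℝ} (hU : IsOpen U) {u g h : ℝ → ℝ}
    (hg : LocallyIntegrableOn g U) (hh : LocallyIntegrableOn h U)
    (hug : IsWeakDeriv U u g) (huh : IsWeakDeriv U u h) : g =ᵐ[volume.restrict U] h := by
  have key : ∀ᵐ x, x ∈ U → (g - h) x = 0 := by
    refine hU.ae_eq_zero_of_integral_contDiff_smul_eq_zero (hg.sub hh) fun φ hφ hc hs => ?_
    have h0 : ∀ x ∉ U, φ x = 0 := fun x hx => notMem_tsupport_eq_zero hs hx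
    have hint : ∀ k : ℝ → ℝ, LocallyIntegrableOn k U →
        IntegrableOn (fun t => k t * φ t) U := fun k hk => by
      have h1 : IntegrableOn (fun t => k t * φ t) (tsupport φ) :=
        (hk.integrableOn_compact_subset hs hc).mul_continuousOn hφ.continuous.continuousOn hc
      refine IntegrableOn.of_forall_sdiff_eq_zero h1 hU.measurableSet fun t ht => ?_
      rw [image_eq_zero_of_notMem_tsupport ht.2, mul_zero]
    have e : ∫ x, φ x • (g - h) x = ∫ x in U, (g x * φ x - h x * φ x) := by
      rw [← setIntegral_eq_integral_of_forall_compl_eq_zero (s := U)]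
      · refine setIntegral_congr_fun hU.measurableSet fun x _ => ?_
        simp only [smul_eq_mul, Pi.sub_apply]; ring
      · intro x hx; simp [h0 x hx]
    rw [e, integral_sub (hint g hg) (hint h hh)]
    have := hug φ hφ hc hs
    have := huh φ hφ hc hs
    linarith
  rw [Filter.EventuallyEq, ae_restrict_iff' hU.measurableSet]
  filter_upwards [key] with x hx hxU
  simpa [sub_eq_zero] using hx hxU

theorem weakDeriv_spec {U : Set ℝ} {u : ℝ → ℝ} (h : MemSobolev U u) :
    MemLp (weakDeriv U u) 2 (volume.restrict U) ∧ IsWeakDeriv U u (weakDeriv U u) := by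
  have h2 := h.2
  rw [weakDeriv, dif_pos h2]
  exact h2.choose_spec

theorem weakDeriv_ae_eq {U : Set ℝ} (hU : IsOpen U) {u g : ℝ → ℝ}
    (hg : MemLp g 2 (volume.restrict U)) (h : IsWeakDeriv U u g) :
    weakDeriv U u =ᵐ[volume.restrict U] g := by
  have h2 : ∃ g, MemLp g 2 (volume.restrict U) ∧ IsWeakDeriv U u g := ⟨g, hg, h⟩
  have := h2.choose_spec
  rw [weakDeriv, dif_pos h2]
  exact isWeakDeriv_ae_unique hU this.1.locallyIntegrableOn_two hg.locallyIntegrableOn_two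
    this.2 h

/-- Integration by parts for absolutely continuous functions; the boundary terms vanish because the
test function is zero at both ends. -/
theorem isWeakDeriv_Ioo_of_eq_integral {a b : ℝ} (hab : a ≤ b) {u g : ℝ → ℝ}
    (hg : IntervalIntegrable g volume a b)
    (h : ∀ x ∈ Ioo a b, u x = u a + ∫ t in a..x, g t) : IsWeakDeriv (Ioo a b) u g := by
  intro φ hφ hc hs
  set H : ℝ → ℝ := fun x => u a + ∫ t in a..x, g t with hH
  have hHac : AbsolutelyContinuousOnInterval H a b := by
    refine AbsolutelyContinuousOnInterval.add (f := fun _ => u a)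
      (ContDiffOn.absolutelyContinuousOnInterval contDiffOn_const)
      (hg.absolutelyContinuousOnInterval_intervalIntegral left_mem_uIcc)
  have hφac : AbsolutelyContinuousOnInterval φ a b :=
    (hφ.of_le (by exact_mod_cast le_top)).contDiffOn.absolutelyContinuousOnInterval
  have ha : φ a = 0 := notMem_tsupport_eq_zero hs (by simp)
  have hb : φ b = 0 := notMem_tsupport_eq_zero hs (by simp)
  have key := hHac.integral_mul_deriv_eq_deriv_mul hφac
  rw [ha, hb] at key
  have e1 : ∫ t in Ioo a b, u t * deriv φ t = ∫ x in a..b, H x * deriv φ x := by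
    rw [intervalIntegral.integral_of_le hab, integral_Ioc_eq_integral_Ioo]
    exact setIntegral_congr_fun measurableSet_Ioo fun x hx => by simp only [h x hx, hH]
  have e2 : ∫ t in Ioo a b, g t * φ t = ∫ x in a..b, deriv H x * φ x := by
    rw [← integral_Ioc_eq_integral_Ioo, ← intervalIntegral.integral_of_le hab]
    refine intervalIntegral.integral_congr_ae ?_
    filter_upwards [hg.ae_hasDerivAt_integral] with x hx hx'
    have := (hx (uIoc_subset_uIcc hx') a left_mem_uIcc).const_add (u a)
    rw [this.deriv]
  rw [e1, e2, key]
  ring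

/-- The primitive starting at `a` vanishes to the left of the support of `ψ`, and the zero integral
makes it vanish to the right as well. -/
theorem exists_testFunction_primitive {a b : ℝ} {ψ : ℝ → ℝ} (hψ : ContDiff ℝ ∞ ψ)
    (hc : HasCompactSupport ψ) (hs : tsupport ψ ⊆ Ioo a b) (h0 : ∫ t, ψ t = 0) :
    ∃ φ : ℝ → ℝ, ContDiff ℝ ∞ φ ∧ HasCompactSupport φ ∧ tsupport φ ⊆ Ioo a b ∧
      deriv φ = ψ := by
  rcases (tsupport ψ).eq_empty_or_nonempty with he | hne
  · rw [tsupport_eq_empty_iff] at he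
    refine ⟨0, contDiff_const, HasCompactSupport.zero, by simp [tsupport], ?_⟩
    rw [he]; ext; simp
  obtain ⟨c, hcm, hcl⟩ := hc.exists_isLeast hne
  obtain ⟨d, hdm, hdl⟩ := hc.exists_isGreatest hne
  have hd : ∀ x, HasDerivAt (fun x => ∫ t in a..x, ψ t) (ψ x) x := fun x =>
    intervalIntegral.integral_hasDerivAt_right (hψ.continuous.intervalIntegrable _ _)
      (hψ.continuous.stronglyMeasurableAtFilter _ _) hψ.continuous.continuousAt
  have hdd : deriv (fun x => ∫ t in a..x, ψ t) = ψ := funext fun x => (hd x).deriv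
  have hac : a < c := (hs hcm).1
  have hdb : d < b := (hs hdm).2
  have hz : ∀ x ∉ Icc c d, (∫ t in a..x, ψ t) = 0 := by
    intro x hx
    have hz1 : ∀ t, t < c → ψ t = 0 := fun t ht =>
      image_eq_zero_of_notMem_tsupport fun h => absurd (hcl h) (not_le.2 ht)
    have hz2 : ∀ t, d < t → ψ t = 0 := fun t ht =>
      image_eq_zero_of_notMem_tsupport fun h => absurd (hdl h) (not_le.2 ht)
    by_cases hxc : x < c
    · refine intervalIntegral.integral_zero_ae (ae_of_all _ fun t ht => hz1 t ?_)
      rcases mem_uIoc.1 ht with h | h <;> linarith [h.2]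
    · have hxd : d < x := by
        by_contra hcon; exact hx ⟨not_lt.1 hxc, not_lt.1 hcon⟩
      rw [← h0, intervalIntegral.integral_of_le (by linarith [hcl hdm])]
      refine setIntegral_eq_integral_of_forall_compl_eq_zero fun t ht => ?_
      by_cases hta : a < t
      · exact hz2 t (lt_of_lt_of_le hxd (le_of_not_ge fun h => ht ⟨hta, h⟩))
      · exact hz1 t (by linarith)
  have hts : tsupport (fun x => ∫ t in a..x, ψ t) ⊆ Icc c d :=
    closure_minimal (fun x hx => by_contra fun h => hx (hz x h)) isClosed_Icc
  refine ⟨_, ?_, HasCompactSupport.of_support_subset_isCompact isCompact_Icc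
    ((subset_tsupport _).trans hts), hts.trans fun x hx => ⟨hac.trans_le hx.1, hx.2.trans_lt hdb⟩,
    hdd⟩
  rw [contDiff_infty_iff_deriv]
  exact ⟨fun x => (hd x).differentiableAt, by rwa [hdd]⟩

theorem exists_testFunction_integral_eq_one {a b : ℝ} (hab : a < b) :
    ∃ η : ℝ → ℝ, ContDiff ℝ ∞ η ∧ HasCompactSupport η ∧ tsupport η ⊆ Ioo a b ∧
      ∫ t, η t = 1 := by
  let f : ContDiffBump ((a + b) / 2) := ⟨(b - a) / 8, (b - a) / 4, by linarith, by linarith⟩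
  refine ⟨f.normed volume, f.contDiff_normed, f.hasCompactSupport_normed, ?_, f.integral_normed⟩
  rw [f.tsupport_normed_eq]
  intro x hx
  have h2 : |x - (a + b) / 2| ≤ (b - a) / 4 := hx
  rw [abs_le] at h2
  constructor <;> linarith [h2.1, h2.2]

/-- Du Bois-Reymond: with a fixed test function `η` of integral `1`, each `ψ - (∫ ψ) η` is the
derivative of a test function, hence orthogonal to `w`. So `w - ∫ w η` is orthogonal to every test
function `ψ`. -/
theorem IsWeakDeriv.eq_of_zero {a b : ℝ} (hab : a < b) {w : ℝ → ℝ}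
    (hw : ContinuousOn w (Icc a b)) (h : IsWeakDeriv (Ioo a b) w 0) : w b = w a := by
  obtain ⟨η, hη, hηc, hηs, hη1⟩ := exists_testFunction_integral_eq_one hab
  have hwi : ∀ φ : ℝ → ℝ, ContDiff ℝ ∞ φ → IntegrableOn (fun t => w t * φ t) (Ioo a b) :=
    fun φ hφ => ((hw.mul hφ.continuous.continuousOn).integrableOn_Icc).mono_set Ioo_subset_Icc_self
  set C := ∫ t in Ioo a b, w t * η t with hC
  have hsupp : ∀ φ : ℝ → ℝ, tsupport φ ⊆ Ioo a b → ∫ t in Ioo a b, φ t = ∫ t, φ t :=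
    fun φ hs => setIntegral_eq_integral_of_forall_compl_eq_zero
      fun x hx => notMem_tsupport_eq_zero hs hx
  have hae : ∀ᵐ x, x ∈ Ioo a b → w x - C = 0 := by
    refine isOpen_Ioo.ae_eq_zero_of_integral_contDiff_smul_eq_zero
      (f := fun x => w x - C) ?_ fun ψ hψ hψc hψs => ?_
    · exact ((hw.mono Ioo_subset_Icc_self).sub continuousOn_const).locallyIntegrableOn
        measurableSet_Ioo
    · set c := ∫ t, ψ t with hc
      have hcψ : ContDiff ℝ ∞ (fun t => ψ t - c * η t) := hψ.sub (contDiff_const.mul hη)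
      have hψs' : tsupport (fun t => ψ t - c * η t) ⊆ tsupport ψ ∪ tsupport η := by
        refine closure_minimal (fun x hx => ?_)
          ((isClosed_tsupport _).union (isClosed_tsupport _))
        by_contra hcon
        rw [mem_union, not_or] at hcon
        apply hx
        simp [image_eq_zero_of_notMem_tsupport hcon.1, image_eq_zero_of_notMem_tsupport hcon.2]
      have hψcc : HasCompactSupport (fun t => ψ t - c * η t) :=
        IsCompact.of_isClosed_subset (hψc.union hηc) (isClosed_tsupport _) hψs'
      have hi0 : ∫ t, (ψ t - c * η t) = 0 := by
        rw [integral_sub (hψ.continuous.integrable_of_hasCompactSupport hψc)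
          ((hη.continuous.integrable_of_hasCompactSupport hηc).const_mul c),
          integral_const_mul, hη1]
        simp [hc]
      obtain ⟨φ, hφ, hφc, hφs, hφd⟩ := exists_testFunction_primitive hcψ hψcc
        (hψs'.trans (union_subset hψs hηs)) hi0
      have h1 := h φ hφ hφc hφs
      rw [hφd] at h1
      simp only [Pi.zero_apply, zero_mul, integral_zero, neg_zero] at h1
      have h2 : ∫ t in Ioo a b, w t * (ψ t - c * η t) =
          (∫ t in Ioo a b, w t * ψ t) - c * C := by
        rw [hC, ← integral_const_mul, ← integral_sub (hwi ψ hψ) ((hwi η hη).const_mul c)]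
        refine integral_congr_ae (ae_of_all _ fun t => ?_)
        ring
      have h3 : ∫ x, ψ x • (w x - C) = ∫ t in Ioo a b, (w t * ψ t - C * ψ t) := by
        rw [← setIntegral_eq_integral_of_forall_compl_eq_zero (s := Ioo a b)]
        · refine integral_congr_ae (ae_of_all _ fun t => ?_)
          simp only [smul_eq_mul]; ring
        · intro x hx; simp [notMem_tsupport_eq_zero hψs hx]
      have hψi : IntegrableOn ψ (Ioo a b) :=
        (hψ.continuous.integrable_of_hasCompactSupport hψc).integrableOn
      rw [h3, integral_sub (hwi ψ hψ) (hψi.const_mul C), integral_const_mul, hsupp ψ hψs, ← hc]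
      linarith
  have hEq : EqOn w (fun _ => C) (Ioo a b) := by
    refine Measure.eqOn_open_of_ae_eq (μ := volume) ?_ isOpen_Ioo (hw.mono Ioo_subset_Icc_self)
      continuousOn_const
    rw [Filter.EventuallyEq, ae_restrict_iff' measurableSet_Ioo]
    filter_upwards [hae] with x hx hx'
    linarith [hx hx']
  have hEq' : EqOn w (fun _ => C) (Icc a b) :=
    hEq.of_subset_closure hw continuousOn_const Ioo_subset_Icc_self
      (by rw [closure_Ioo hab.ne])
  rw [hEq' (right_mem_Icc.2 hab.le), hEq' (left_mem_Icc.2 hab.le)]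

theorem IsWeakDeriv.sub_eq_integral {U : Set ℝ} (hU : IsOpen U) {a b : ℝ} (hab : a ≤ b)
    (hs : Ioo a b ⊆ U) {u g : ℝ → ℝ} (hu : ContinuousOn u (Icc a b))
    (hg : IntervalIntegrable g volume a b) (h : IsWeakDeriv U u g) :
    u b - u a = ∫ t in a..b, g t := by
  rcases hab.eq_or_lt with rfl | hab'
  · simp
  have h1 := h.mono hU.measurableSet hs
  have h2 : IsWeakDeriv (Ioo a b) (fun x => ∫ t in a..x, g t) g :=
    isWeakDeriv_Ioo_of_eq_integral hab hg fun x _ => by simp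
  have hGc : ContinuousOn (fun x => ∫ t in a..x, g t) (Icc a b) := by
    have := (hg.absolutelyContinuousOnInterval_intervalIntegral left_mem_uIcc).continuousOn
    rwa [uIcc_of_le hab] at this
  have h3 : IsWeakDeriv (Ioo a b) (fun x => u x - ∫ t in a..x, g t) 0 := by
    intro φ hφ hc hφs
    have hint : ∀ v : ℝ → ℝ, ContinuousOn v (Icc a b) →
        IntegrableOn (fun t => v t * deriv φ t) (Ioo a b) := fun v hv =>
      ((hv.mul (hφ.continuous_deriv (by simp)).continuousOn).integrableOn_Icc).mono_set
        Ioo_subset_Icc_self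
    simp only [sub_mul, Pi.zero_apply, zero_mul, integral_zero, neg_zero]
    rw [integral_sub (hint u hu) (hint _ hGc), h1 φ hφ hc hφs, h2 φ hφ hc hφs, sub_self]
  have := h3.eq_of_zero hab' (hu.sub hGc)
  simp only [Pi.sub_apply] at this
  have h0 : ∫ t in a..a, g t = 0 := intervalIntegral.integral_same
  linarith

/-- A continuous function that vanishes outside the open set `U` and has a weak derivative on `U`
is a primitive of this weak derivative, extended by zero. -/
theorem IsWeakDeriv.sub_eq_integral_indicator {U : Set ℝ} (hU : IsOpen U) {a b : ℝ} (hab : a ≤ b)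
    {u g : ℝ → ℝ} (hu : ContinuousOn u (Icc a b)) (hz : ∀ x ∈ Ioo a b, x ∉ U → u x = 0)
    (hg : IntegrableOn g U) (h : IsWeakDeriv U u g) :
    u b - u a = ∫ t in a..b, U.indicator g t := by
  set k := U.indicator g with hk
  have hki : Integrable k := hg.integrable_indicator hU.measurableSet
  have hkU : ∀ s t : ℝ, s ≤ t → Ioo s t ⊆ U → Icc s t ⊆ Icc a b → u t - u s = ∫ x in s..t, k x := by
    intro s t hst hsub hsub2
    refine IsWeakDeriv.sub_eq_integral hU hst hsub (hu.mono hsub2) hki.intervalIntegrable ?_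
    exact h.congr hU.measurableSet (fun _ _ => rfl) fun x hx => (indicator_of_mem hx g).symm
  have hkabs : ∀ s t : ℝ, s ≤ t → Ioo s t ⊆ U → Icc s t ⊆ Icc a b →
      |u t - u s| ≤ ∫ x in s..t, |k x| := by
    intro s t hst h1 h2
    rw [hkU s t hst h1 h2]
    exact intervalIntegral.abs_integral_le_integral_abs hst
  have hmono : ∀ s t s' t' : ℝ, s ≤ t → s' ≤ s → t ≤ t' →
      ∫ x in s..t, |k x| ≤ ∫ x in s'..t', |k x| := fun s t s' t' h1 h2 h3 =>
    intervalIntegral.integral_mono_interval h2 h1 h3 (ae_of_all _ fun x => abs_nonneg _)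
      hki.abs.intervalIntegrable
  -- `U` may have infinitely many components. If the interval leaves `U`, let `c` and `d` be the
  -- first and last points of the closure of the part outside `U`. There `u` vanishes, so only the
  -- end pieces, which lie in `U`, contribute to the increment.
  have hbd : ∀ s t : ℝ, s ≤ t → a ≤ s → t ≤ b → |u t - u s| ≤ ∫ x in s..t, |k x| := by
    intro s t hst has htb
    by_cases hsub : Ioo s t ⊆ U
    · exact hkabs s t hst hsub (Icc_subset_Icc has htb)
    have hcu : ContinuousOn u (Icc s t) := hu.mono (Icc_subset_Icc has htb)
    set Z := closure (Ioo s t \ U) with hZ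
    have hZne : Z.Nonempty := by
      rw [not_subset] at hsub
      obtain ⟨x, hx, hxU⟩ := hsub
      exact ⟨x, subset_closure ⟨hx, hxU⟩⟩
    have hZsub : Z ⊆ Icc s t :=
      closure_minimal (sdiff_subset.trans Ioo_subset_Icc_self) isClosed_Icc
    have hZc : IsCompact Z := isCompact_Icc.of_isClosed_subset isClosed_closure hZsub
    have hZ0 : ∀ x ∈ Z, u x = 0 := by
      intro x hx
      have hcl : IsClosed (Icc s t ∩ u ⁻¹' {0}) :=
        hcu.preimage_isClosed_of_isClosed isClosed_Icc isClosed_singleton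
      have : Z ⊆ Icc s t ∩ u ⁻¹' {0} := closure_minimal (fun y hy =>
        ⟨Ioo_subset_Icc_self hy.1, hz y ⟨by linarith [hy.1.1], by linarith [hy.1.2]⟩ hy.2⟩) hcl
      exact (this hx).2
    obtain ⟨c, hcm, hcl⟩ := hZc.exists_isLeast hZne
    obtain ⟨d, hdm, hdl⟩ := hZc.exists_isGreatest hZne
    have hc1 := hZsub hcm
    have hd1 := hZsub hdm
    have h1 := hkabs s c hc1.1 (fun x hx => by
      by_contra hxU
      have := hcl (subset_closure ⟨⟨hx.1, hx.2.trans_le hc1.2⟩, hxU⟩)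
      linarith [hx.2]) (Icc_subset_Icc has (hc1.2.trans htb))
    have h2 := hkabs d t hd1.2 (fun x hx => by
      by_contra hxU
      have := hdl (subset_closure ⟨⟨hd1.1.trans_lt hx.1, hx.2⟩, hxU⟩)
      linarith [hx.1]) (Icc_subset_Icc (has.trans hd1.1) htb)
    have h3 : ∫ x in s..t, |k x| =
        (∫ x in s..c, |k x|) + (∫ x in c..d, |k x|) + ∫ x in d..t, |k x| := by
      rw [intervalIntegral.integral_add_adjacent_intervals hki.abs.intervalIntegrable
        hki.abs.intervalIntegrable, intervalIntegral.integral_add_adjacent_intervals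
        hki.abs.intervalIntegrable hki.abs.intervalIntegrable]
    have h4 : 0 ≤ ∫ x in c..d, |k x| :=
      intervalIntegral.integral_nonneg (hcl hdm) fun _ _ => abs_nonneg _
    rw [hZ0 c hcm] at h1
    rw [hZ0 d hdm] at h2
    have : |u t - u s| ≤ |u t - 0| + |0 - u s| := by
      have := abs_add_le (u t - 0) (0 - u s)
      simpa [sub_eq_add_neg] using this
    linarith
  set W : ℝ → ℝ := fun x => ∫ t in a..x, |k t| with hW
  have hWsub : ∀ s t : ℝ, W t - W s = ∫ x in s..t, |k x| := fun s t =>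
    intervalIntegral.integral_interval_sub_left hki.abs.intervalIntegrable
      hki.abs.intervalIntegrable
  -- Increments of `u` are dominated by those of the absolutely continuous function `W`, so `u` is
  -- absolutely continuous too. It remains to show that `u` minus the primitive of `k` has
  -- derivative zero almost everywhere.
  have hdist : ∀ s ∈ Icc a b, ∀ t ∈ Icc a b, dist (u s) (u t) ≤ dist (W s) (W t) := by
    have aux : ∀ s ∈ Icc a b, ∀ t ∈ Icc a b, s ≤ t → dist (u t) (u s) ≤ dist (W t) (W s) := by
      intro s hs t ht hst
      rw [Real.dist_eq, Real.dist_eq, hWsub]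
      exact (hbd s t hst hs.1 ht.2).trans (le_abs_self _)
    intro s hs t ht
    rcases le_total s t with hst | hst
    · rw [dist_comm (u s), dist_comm (W s)]; exact aux s hs t ht hst
    · exact aux t ht s hs hst
  have hWac : AbsolutelyContinuousOnInterval W a b :=
    IntervalIntegrable.absolutelyContinuousOnInterval_intervalIntegral
      hki.abs.intervalIntegrable left_mem_uIcc
  have hKac : AbsolutelyContinuousOnInterval (fun x => ∫ t in a..x, k t) a b :=
    IntervalIntegrable.absolutelyContinuousOnInterval_intervalIntegral
      hki.intervalIntegrable left_mem_uIcc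
  have huac : AbsolutelyContinuousOnInterval u a b := by
    rw [absolutelyContinuousOnInterval_iff] at hWac ⊢
    intro ε hε
    obtain ⟨δ, hδ, hh⟩ := hWac ε hε
    refine ⟨δ, hδ, fun E hE hEs => lt_of_le_of_lt (Finset.sum_le_sum fun i hi => ?_) (hh E hE hEs)⟩
    have := hE.1 i hi
    rw [uIcc_of_le hab] at this
    exact hdist _ this.1 _ this.2
  have hFac := huac.sub hKac
  have hd : ∀ᵐ x, x ∈ uIcc a b → HasDerivAt (u - fun x => ∫ t in a..x, k t) 0 x := by
    have ha : ∀ᵐ x : ℝ, x ≠ a := by simp [ae_iff, measure_singleton]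
    have hb : ∀ᵐ x : ℝ, x ≠ b := by simp [ae_iff, measure_singleton]
    filter_upwards [LocallyIntegrable.ae_hasDerivAt_integral hki.locallyIntegrable,
      LocallyIntegrable.ae_hasDerivAt_integral hki.abs.locallyIntegrable, ha, hb] with x h1 h2 hxa hxb hx
    rw [uIcc_of_le hab] at hx
    have hxo : x ∈ Ioo a b := ⟨lt_of_le_of_ne hx.1 (Ne.symm hxa), lt_of_le_of_ne hx.2 hxb⟩
    by_cases hxU : x ∈ U
    · obtain ⟨ε, hε, hball⟩ := Metric.isOpen_iff.1 (hU.inter isOpen_Ioo) x ⟨hxU, hxo⟩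
      rw [Real.ball_eq_Ioo] at hball
      have hloc : (u - fun x => ∫ t in a..x, k t) =ᶠ[𝓝 x]
          fun _ => u x - ∫ t in a..x, k t := by
        filter_upwards [Ioo_mem_nhds (show x - ε < x by linarith) (show x < x + ε by linarith)]
          with y hy
        have hsplit : (∫ t in a..y, k t) - ∫ t in a..x, k t = ∫ t in x..y, k t :=
          intervalIntegral.integral_interval_sub_left hki.intervalIntegrable
            hki.intervalIntegrable
        have hin : ∀ z ∈ Icc (min x y) (max x y), z ∈ U ∩ Ioo a b := fun z hz => hball
          ⟨lt_of_lt_of_le (lt_min (by linarith) hy.1) hz.1,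
            lt_of_le_of_lt hz.2 (max_lt (by linarith) hy.2)⟩
        have : u y - u x = ∫ t in x..y, k t := by
          rcases le_total x y with hxy | hxy
          · rw [min_eq_left hxy, max_eq_right hxy] at hin
            exact hkU x y hxy (fun z hz => (hin z (Ioo_subset_Icc_self hz)).1)
              fun z hz => Ioo_subset_Icc_self (hin z hz).2
          · rw [min_eq_right hxy, max_eq_left hxy] at hin
            rw [intervalIntegral.integral_symm, ← hkU y x hxy
              (fun z hz => (hin z (Ioo_subset_Icc_self hz)).1)
              fun z hz => Ioo_subset_Icc_self (hin z hz).2]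
            ring
        simp only [Pi.sub_apply]
        linarith
      exact (hasDerivAt_const x _).congr_of_eventuallyEq hloc
    -- At almost every point outside `U`, `W` has derivative `|k x| = 0`, and domination by `W`
    -- forces `u` to have derivative zero.
    · have hk0 : k x = 0 := indicator_of_notMem hxU g
      have h1' := h1 a
      have h2' := h2 a
      rw [hk0] at h1' h2'
      rw [abs_zero] at h2'
      have hu0 : HasDerivAt u 0 x := by
        rw [hasDerivAt_iff_isLittleO] at h2' ⊢
        refine Asymptotics.IsBigO.trans_isLittleO ?_ h2'
        refine Asymptotics.IsBigO.of_bound 1 ?_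
        filter_upwards [Ioo_mem_nhds hxo.1 hxo.2] with y hy
        have := hdist y (Ioo_subset_Icc_self hy) x hx
        rw [Real.dist_eq, Real.dist_eq] at this
        simpa using this
      simpa using hu0.sub h1'
  obtain ⟨C, hC⟩ := hFac.const_of_ae_hasDerivAt_zero hd
  have e1 := hC a left_mem_uIcc
  have e2 := hC b right_mem_uIcc
  simp only [Pi.sub_apply, intervalIntegral.integral_same] at e1 e2
  linarith

/-- A continuous function that vanishes outside the open set `U` and has a weak derivative on `U`
has a weak derivative on the whole interval, which vanishes outside `U`. -/
theorem isWeakDeriv_Ioo_indicator {U : Set ℝ} (hU : IsOpen U) {a b : ℝ} (hab : a ≤ b)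
    {u g : ℝ → ℝ} (hu : ContinuousOn u (Icc a b)) (hz : ∀ x ∈ Ioo a b, x ∉ U → u x = 0)
    (hg : IntegrableOn g U) (h : IsWeakDeriv U u g) :
    IsWeakDeriv (Ioo a b) u (U.indicator g) := by
  refine isWeakDeriv_Ioo_of_eq_integral hab
    (hg.integrable_indicator hU.measurableSet).intervalIntegrable fun x hx => ?_
  have := h.sub_eq_integral_indicator hU hx.1.le (hu.mono (Icc_subset_Icc le_rfl hx.2.le))
    (fun y hy => hz y ⟨hy.1, hy.2.trans hx.2⟩) hg
  linarith

theorem ContinuousOn.memLp_Ioo {a b : ℝ} {u : ℝ → ℝ} (hu : ContinuousOn u (Icc a b)) :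
    MemLp u 2 (volume.restrict (Ioo a b)) := by
  obtain ⟨C, hC⟩ := isCompact_Icc.exists_bound_of_continuousOn hu
  refine MemLp.of_bound
    ((hu.mono Ioo_subset_Icc_self).aestronglyMeasurable measurableSet_Ioo) C ?_
  rw [ae_restrict_iff' measurableSet_Ioo]
  exact ae_of_all _ fun x hx => hC x (Ioo_subset_Icc_self hx)

theorem MeasureTheory.MemLp.integrableOn_Ioo {a b : ℝ} {U : Set ℝ} (hU : U ⊆ Ioo a b) {g : ℝ → ℝ}
    (hg : MemLp g 2 (volume.restrict U)) : IntegrableOn g U := by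
  have : IsFiniteMeasure (volume.restrict U) :=
    ⟨by rw [Measure.restrict_apply_univ]; exact (measure_mono hU).trans_lt measure_Ioo_lt_top⟩
  exact hg.integrable (by norm_num)

theorem MeasureTheory.MemLp.intervalIntegrable_of_Ioo {a b : ℝ} {g : ℝ → ℝ}
    (hg : MemLp g 2 (volume.restrict (Ioo a b))) {s t : ℝ} (hs : a ≤ s) (hst : s ≤ t)
    (ht : t ≤ b) : IntervalIntegrable g volume s t := by
  rw [intervalIntegrable_iff_integrableOn_Ioo_of_le hst]
  exact (hg.integrableOn_Ioo subset_rfl).mono_set (Ioo_subset_Ioo hs ht)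

namespace MetricGraph

variable {V E : Type*}

/-! ## The topology of a metric graph -/

/-- A vertex as a point of the metric graph. -/
def vertex (G : MetricGraph V E) (v : V) : G.Point := Quot.mk _ (Sum.inl v)

theorem edgeMap_zero (G : MetricGraph V E) (e : E) : G.edgeMap e 0 = G.vertex (G.src e) := by
  rw [edgeMap, projIcc_left]
  exact Quot.sound (Glue.left e)

theorem edgeMap_len (G : MetricGraph V E) (e : E) :
    G.edgeMap e (G.len e) = G.vertex (G.tgt e) := by
  rw [edgeMap, projIcc_right]
  exact Quot.sound (Glue.right e)

theorem point_cases (G : MetricGraph V E) (p : G.Point) :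
    (∃ v, p = G.vertex v) ∨ ∃ e, ∃ t ∈ Icc 0 (G.len e), p = G.edgeMap e t := by
  induction p using Quot.ind with
  | mk q =>
    rcases q with v | ⟨e, t⟩
    · exact Or.inl ⟨v, rfl⟩
    · exact Or.inr ⟨e, t, t.2, by rw [edgeMap, projIcc_val]⟩

theorem continuous_edgeMap (G : MetricGraph V E) (e : E) : Continuous (G.edgeMap e) := by
  let : TopologicalSpace V := ⊥
  have h1 : Continuous (Quot.mk G.Glue) := continuous_quot_mk
  have h2 : Continuous (fun t : ℝ =>
      (⟨e, Set.projIcc 0 (G.len e) (G.len_pos e).le t⟩ : Σ e : E, Set.Icc (0 : ℝ) (G.len e))) :=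
    continuous_sigmaMk.comp continuous_projIcc
  have h3 : Continuous (Sum.inr : (Σ e : E, Set.Icc (0 : ℝ) (G.len e)) → G.PrePoint) :=
    continuous_inr
  exact h1.comp (h3.comp h2)

theorem continuous_of_edges (G : MetricGraph V E) {X : Type*} [TopologicalSpace X]
    {F : G.Point → X} (h : ∀ e, ContinuousOn (fun t => F (G.edgeMap e t)) (Icc 0 (G.len e))) :
    Continuous F := by
  let : TopologicalSpace V := ⊥
  have : DiscreteTopology V := ⟨rfl⟩
  have hq : IsQuotientMap (Quot.mk G.Glue) := isQuotientMap_quot_mk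
  have : Continuous (F ∘ Quot.mk G.Glue) := by
    refine continuous_sum_dom.2 ⟨continuous_of_discreteTopology, continuous_sigma fun e => ?_⟩
    refine (continuousOn_iff_continuous_domRestrict.1 (h e)).congr fun t => ?_
    simp only [domRestrict_apply, edgeMap, projIcc_val]
    rfl
  exact hq.continuous_iff.2 this

theorem compactSpace_point (G : MetricGraph V E) [Finite V] [Finite E] :
    CompactSpace G.Point := by
  let : TopologicalSpace V := ⊥
  have : DiscreteTopology V := ⟨rfl⟩
  have : CompactSpace (Σ e : E, Set.Icc (0 : ℝ) (G.len e)) := inferInstance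
  have : CompactSpace G.PrePoint :=
    inferInstanceAs (CompactSpace (V ⊕ (Σ e : E, Set.Icc (0 : ℝ) (G.len e))))
  exact inferInstanceAs (CompactSpace (Quot G.Glue))

theorem nonempty_point (G : MetricGraph V E) : Nonempty G.Point :=
  G.nonempty.map G.vertex

/-! ## Sobolev functions -/

theorem isOpen_edgeDomain (G : MetricGraph V E) (K : Set G.Point) (e : E) :
    IsOpen (G.edgeDomain K e) := isOpen_Ioo.inter isOpen_interior

theorem edgeDomain_subset (G : MetricGraph V E) (K : Set G.Point) (e : E) :
    G.edgeDomain K e ⊆ Ioo 0 (G.len e) := inter_subset_left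

@[simp] theorem edgeDomain_univ (G : MetricGraph V E) (e : E) :
    G.edgeDomain univ e = Ioo 0 (G.len e) := by simp [edgeDomain]

theorem edgeMap_mem_of_mem_edgeDomain {G : MetricGraph V E} {K : Set G.Point} {e : E} {t : ℝ}
    (ht : t ∈ G.edgeDomain K e) : G.edgeMap e t ∈ K :=
  interior_subset (s := G.edgeMap e ⁻¹' K) ht.2

/-- Used to see that a function vanishing outside `K` and on its frontier is zero at the points of
an open edge outside `edgeDomain`. -/
theorem edgeMap_notMem_interior {G : MetricGraph V E} {K : Set G.Point} {e : E} {t : ℝ}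
    (ht : t ∈ Ioo 0 (G.len e)) (h : t ∉ G.edgeDomain K e) : G.edgeMap e t ∉ interior K :=
  fun hi => h ⟨ht, preimage_interior_subset_interior_preimage (G.continuous_edgeMap e) hi⟩

/-- The derivative along the edge `e` of a function in `H¹(G)`. -/
def slope (G : MetricGraph V E) (f : G.Point → ℝ) (e : E) : ℝ → ℝ :=
  weakDeriv (Ioo 0 (G.len e)) (fun t => f (G.edgeMap e t))

theorem mem_H1_univ {G : MetricGraph V E} {f : G.Point → ℝ} :
    f ∈ G.H1 univ ↔ Continuous f ∧
      ∀ e, MemSobolev (Ioo 0 (G.len e)) (fun t => f (G.edgeMap e t)) := by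
  simp [H1, continuousOn_univ]

theorem continuous_edge {G : MetricGraph V E} {f : G.Point → ℝ} (hf : f ∈ G.H1 univ) (e : E) :
    Continuous (fun t => f (G.edgeMap e t)) :=
  (mem_H1_univ.1 hf).1.comp (G.continuous_edgeMap e)

theorem memLp_slope {G : MetricGraph V E} {f : G.Point → ℝ} (hf : f ∈ G.H1 univ) (e : E) :
    MemLp (G.slope f e) 2 (volume.restrict (Ioo 0 (G.len e))) :=
  (weakDeriv_spec ((mem_H1_univ.1 hf).2 e)).1

theorem isWeakDeriv_slope {G : MetricGraph V E} {f : G.Point → ℝ} (hf : f ∈ G.H1 univ) (e : E) :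
    IsWeakDeriv (Ioo 0 (G.len e)) (fun t => f (G.edgeMap e t)) (G.slope f e) :=
  (weakDeriv_spec ((mem_H1_univ.1 hf).2 e)).2

theorem sub_eq_integral_slope {G : MetricGraph V E} {f : G.Point → ℝ} (hf : f ∈ G.H1 univ) (e : E)
    {a b : ℝ} (ha : 0 ≤ a) (hab : a ≤ b) (hb : b ≤ G.len e) :
    f (G.edgeMap e b) - f (G.edgeMap e a) = ∫ t in a..b, G.slope f e t :=
  (isWeakDeriv_slope hf e).sub_eq_integral isOpen_Ioo hab (Ioo_subset_Ioo ha hb)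
    (continuous_edge hf e).continuousOn ((memLp_slope hf e).intervalIntegrable_of_Ioo ha hab hb)

theorem mem_H1_univ_of_isWeakDeriv {G : MetricGraph V E} {f : G.Point → ℝ} {h : E → ℝ → ℝ}
    (hf : Continuous f) (hh : ∀ e, MemLp (h e) 2 (volume.restrict (Ioo 0 (G.len e))))
    (hd : ∀ e, IsWeakDeriv (Ioo 0 (G.len e)) (fun t => f (G.edgeMap e t)) (h e)) :
    f ∈ G.H1 univ ∧ ∀ e, G.slope f e =ᵐ[volume.restrict (Ioo 0 (G.len e))] h e :=
  ⟨mem_H1_univ.2 ⟨hf, fun e =>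
    ⟨(hf.comp (G.continuous_edgeMap e)).continuousOn.memLp_Ioo, h e, hh e, hd e⟩⟩,
    fun e => weakDeriv_ae_eq isOpen_Ioo (hh e) (hd e)⟩

theorem mem_H1_univ_of_eq_integral {G : MetricGraph V E} {f : G.Point → ℝ} {h : E → ℝ → ℝ}
    (hf : Continuous f) (hh : ∀ e, MemLp (h e) 2 (volume.restrict (Ioo 0 (G.len e))))
    (hd : ∀ e, ∀ t ∈ Icc 0 (G.len e), f (G.edgeMap e t) - f (G.edgeMap e 0) =
      ∫ s in 0..t, h e s) :
    f ∈ G.H1 univ ∧ ∀ e, G.slope f e =ᵐ[volume.restrict (Ioo 0 (G.len e))] h e :=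
  mem_H1_univ_of_isWeakDeriv hf hh fun e =>
    isWeakDeriv_Ioo_of_eq_integral (G.len_pos e).le
      ((hh e).intervalIntegrable_of_Ioo le_rfl (G.len_pos e).le le_rfl) fun t ht => by
        rw [← hd e t (Ioo_subset_Icc_self ht)]; ring

theorem const_mem_H1 (G : MetricGraph V E) (c : ℝ) : (fun _ => c) ∈ G.H1 univ :=
  (mem_H1_univ_of_eq_integral (h := fun _ _ => 0) continuous_const (fun _ => MemLp.zero)
    (by simp)).1

theorem slope_const (G : MetricGraph V E) (c : ℝ) (e : E) :
    G.slope (fun _ => c) e =ᵐ[volume.restrict (Ioo 0 (G.len e))] 0 :=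
  (mem_H1_univ_of_eq_integral (h := fun _ _ => 0) continuous_const (fun _ => MemLp.zero)
    (by simp)).2 e

theorem add_mul_mem_H1_aux {G : MetricGraph V E} {f g : G.Point → ℝ} (hf : f ∈ G.H1 univ)
    (hg : g ∈ G.H1 univ) (c : ℝ) : (fun x => f x + c * g x) ∈ G.H1 univ ∧
      ∀ e, G.slope (fun x => f x + c * g x) e =ᵐ[volume.restrict (Ioo 0 (G.len e))]
        fun t => G.slope f e t + c * G.slope g e t := by
  refine mem_H1_univ_of_eq_integral
    ((mem_H1_univ.1 hf).1.add (continuous_const.mul (mem_H1_univ.1 hg).1))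
    (fun e => (memLp_slope hf e).add ((memLp_slope hg e).const_mul c)) fun e t ht => ?_
  have h1 := sub_eq_integral_slope hf e le_rfl ht.1 ht.2
  have h2 := sub_eq_integral_slope hg e le_rfl ht.1 ht.2
  rw [intervalIntegral.integral_add
    ((memLp_slope hf e).intervalIntegrable_of_Ioo le_rfl ht.1 ht.2)
    (((memLp_slope hg e).intervalIntegrable_of_Ioo le_rfl ht.1 ht.2).const_mul c),
    intervalIntegral.integral_const_mul, ← h1, ← h2]
  ring

theorem add_mul_mem_H1 {G : MetricGraph V E} {f g : G.Point → ℝ} (hf : f ∈ G.H1 univ)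
    (hg : g ∈ G.H1 univ) (c : ℝ) : (fun x => f x + c * g x) ∈ G.H1 univ :=
  (add_mul_mem_H1_aux hf hg c).1

theorem slope_add_mul {G : MetricGraph V E} {f g : G.Point → ℝ} (hf : f ∈ G.H1 univ)
    (hg : g ∈ G.H1 univ) (c : ℝ) (e : E) :
    G.slope (fun x => f x + c * g x) e =ᵐ[volume.restrict (Ioo 0 (G.len e))]
        fun t => G.slope f e t + c * G.slope g e t :=
  (add_mul_mem_H1_aux hf hg c).2 e

theorem mul_mem_H1 {G : MetricGraph V E} {f : G.Point → ℝ} (hf : f ∈ G.H1 univ) (c : ℝ) :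
    (fun x => c * f x) ∈ G.H1 univ := by
  simpa using add_mul_mem_H1 (G.const_mem_H1 0) hf c

theorem add_const_mem_H1 {G : MetricGraph V E} {f : G.Point → ℝ} (hf : f ∈ G.H1 univ) (c : ℝ) :
    (fun x => f x + c) ∈ G.H1 univ := by
  simpa using add_mul_mem_H1 hf (G.const_mem_H1 1) c

/-! ## Restriction and extension by zero -/

/-- The Dirichlet condition makes the extension by zero continuous, and `isWeakDeriv_Ioo_indicator`
extends its derivative by zero. Questions about a piece `K` thus become questions in `H¹(G)`. -/
theorem extend_mem_H1 {G : MetricGraph V E} {K : Set G.Point} (hK : IsClosed K) {f : G.Point → ℝ}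
    (hf : f ∈ G.H10 K (frontier K)) : f ∈ G.H1 univ ∧
      ∀ e, G.slope f e =ᵐ[volume.restrict (Ioo 0 (G.len e))] (G.edgeDomain K e).indicator
        (weakDeriv (G.edgeDomain K e) (fun t => f (G.edgeMap e t))) := by
  obtain ⟨⟨hfc, hf0, hfs⟩, hfA⟩ := hf
  have hcont : Continuous f := by
    have h : Continuous (K.indicator f) := continuous_indicator hfA (by rwa [hK.closure_eq])
    rwa [indicator_eq_self.2 fun x hx => by_contra fun h => hx (hf0 x h)] at h
  have hU := G.isOpen_edgeDomain K
  refine mem_H1_univ_of_isWeakDeriv hcont (fun e => ?_) fun e => ?_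
  · exact ((memLp_indicator_iff_restrict (hU e).measurableSet).2
      (weakDeriv_spec (hfs e)).1).mono_measure Measure.restrict_le_self
  · refine isWeakDeriv_Ioo_indicator (hU e) (G.len_pos e).le
      (hcont.comp (G.continuous_edgeMap e)).continuousOn (fun t ht htU => ?_)
      ((weakDeriv_spec (hfs e)).1.integrableOn_Ioo (G.edgeDomain_subset K e))
      (weakDeriv_spec (hfs e)).2
    have := edgeMap_notMem_interior ht htU
    by_cases hmem : G.edgeMap e t ∈ K
    · exact hfA _ ⟨subset_closure hmem, this⟩
    · exact hf0 _ hmem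

theorem indicator_mem_H1 {G : MetricGraph V E} (K : Set G.Point) {f : G.Point → ℝ}
    (hf : f ∈ G.H1 univ) : K.indicator f ∈ G.H1 K ∧
      ∀ e, weakDeriv (G.edgeDomain K e) (fun t => K.indicator f (G.edgeMap e t))
        =ᵐ[volume.restrict (G.edgeDomain K e)] G.slope f e := by
  have hU := G.isOpen_edgeDomain K
  have hd : ∀ e, IsWeakDeriv (G.edgeDomain K e) (fun t => K.indicator f (G.edgeMap e t))
      (G.slope f e) := fun e =>
    ((isWeakDeriv_slope hf e).mono measurableSet_Ioo (G.edgeDomain_subset K e)).congr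
      (hU e).measurableSet
      (fun t ht => (indicator_of_mem (edgeMap_mem_of_mem_edgeDomain ht) f).symm)
      fun _ _ => rfl
  have hle : ∀ e, volume.restrict (G.edgeDomain K e) ≤ volume.restrict (Ioo 0 (G.len e)) :=
    fun e => Measure.restrict_mono (G.edgeDomain_subset K e) le_rfl
  have hm : ∀ e, MemLp (G.slope f e) 2 (volume.restrict (G.edgeDomain K e)) := fun e =>
    (memLp_slope hf e).mono_measure (hle e)
  refine ⟨⟨?_, fun x hx => indicator_of_notMem hx f, fun e => ⟨?_, _, hm e, hd e⟩⟩,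
    fun e => weakDeriv_ae_eq (hU e) (hm e) (hd e)⟩
  · exact (mem_H1_univ.1 hf).1.continuousOn.congr fun x hx => indicator_of_mem hx f
  · refine (((mem_H1_univ.1 hf).2 e).1.mono_measure (hle e)).ae_eq ?_
    rw [Filter.EventuallyEq, ae_restrict_iff' (hU e).measurableSet]
    exact ae_of_all _ fun t ht => (indicator_of_mem (edgeMap_mem_of_mem_edgeDomain ht) f).symm

theorem indicator_mem_H10 {G : MetricGraph V E} {K : Set G.Point} {f : G.Point → ℝ}
    (hf : f ∈ G.H1 univ) (h0 : ∀ x ∈ frontier K, f x = 0) :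
    K.indicator f ∈ G.H10 K (frontier K) :=
  ⟨(indicator_mem_H1 K hf).1, fun x hx => by
    by_cases hxK : x ∈ K <;> simp [hxK, h0 x hx]⟩

/-! ## The energy form -/

section energy

variable [Fintype E]

theorem energy_univ (G : MetricGraph V E) (f g : G.Point → ℝ) :
    G.energy univ f g = ∑ e, ∫ t in Ioo 0 (G.len e), G.slope f e t * G.slope g e t := by
  simp only [energy, edgeDomain_univ]; rfl

theorem energy_comm (G : MetricGraph V E) (K : Set G.Point) (f g : G.Point → ℝ) :
    G.energy K f g = G.energy K g f := by
  simp only [energy, mul_comm]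

theorem energy_self_nonneg (G : MetricGraph V E) (f : G.Point → ℝ) : 0 ≤ G.energy univ f f := by
  rw [energy_univ]
  exact Finset.sum_nonneg fun e _ => integral_nonneg fun t => mul_self_nonneg _

theorem energy_add_mul_right {G : MetricGraph V E} {f g h : G.Point → ℝ} (hf : f ∈ G.H1 univ)
    (hg : g ∈ G.H1 univ) (hh : h ∈ G.H1 univ) (c : ℝ) :
    G.energy univ f (fun x => g x + c * h x) =
      G.energy univ f g + c * G.energy univ f h := by
  simp only [energy_univ]
  rw [Finset.mul_sum, ← Finset.sum_add_distrib]
  refine Finset.sum_congr rfl fun e _ => ?_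
  rw [← integral_const_mul, ← integral_add]
  · refine integral_congr_ae ?_
    filter_upwards [slope_add_mul hg hh c e] with t ht
    rw [ht]; ring
  · exact (memLp_slope hf e).integrable_mul (memLp_slope hg e)
  · exact ((memLp_slope hf e).integrable_mul (memLp_slope hh e)).const_mul c

theorem energy_const_right (G : MetricGraph V E) (f : G.Point → ℝ) (c : ℝ) :
    G.energy univ f (fun _ => c) = 0 := by
  rw [energy_univ]
  refine Finset.sum_eq_zero fun e _ => ?_
  refine integral_eq_zero_of_ae ?_
  filter_upwards [G.slope_const c e] with t ht
  simp [ht]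

theorem energy_mul_right {G : MetricGraph V E} {f g : G.Point → ℝ} (hf : f ∈ G.H1 univ)
    (hg : g ∈ G.H1 univ) (c : ℝ) :
    G.energy univ f (fun x => c * g x) = c * G.energy univ f g := by
  have := energy_add_mul_right hf (G.const_mem_H1 0) hg c
  simpa [energy_const_right] using this

theorem energy_mul_left {G : MetricGraph V E} {f g : G.Point → ℝ} (hf : f ∈ G.H1 univ)
    (hg : g ∈ G.H1 univ) (c : ℝ) :
    G.energy univ (fun x => c * f x) g = c * G.energy univ f g := by
  rw [energy_comm, energy_mul_right hg hf, energy_comm]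

theorem energy_add_mul_self {G : MetricGraph V E} {f g : G.Point → ℝ} (hf : f ∈ G.H1 univ)
    (hg : g ∈ G.H1 univ) (c : ℝ) :
    G.energy univ (fun x => f x + c * g x) (fun x => f x + c * g x) =
      G.energy univ f f + 2 * c * G.energy univ f g + c ^ 2 * G.energy univ g g := by
  have h := add_mul_mem_H1 hf hg c
  rw [energy_add_mul_right h hf hg, energy_comm _ _ _ f, energy_comm _ _ _ g,
    energy_add_mul_right hf hf hg, energy_add_mul_right hg hf hg, energy_comm _ _ g f]
  ring

theorem energy_add_const_left {G : MetricGraph V E} {f g : G.Point → ℝ} (hf : f ∈ G.H1 univ)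
    (hg : g ∈ G.H1 univ) (c : ℝ) :
    G.energy univ (fun x => f x + c) g = G.energy univ f g := by
  have := energy_add_mul_right hg hf (G.const_mem_H1 1) c
  rw [energy_comm]
  simpa [energy_const_right, energy_comm] using this

/-- On the open set `U` where `f ≠ 0` the function `g` vanishes, hence so does its derivative almost
everywhere; off `U` the derivative of `f` vanishes almost everywhere. -/
theorem energy_eq_zero_of_mul_eq_zero {G : MetricGraph V E} {f g : G.Point → ℝ}
    (hf : f ∈ G.H1 univ) (hg : g ∈ G.H1 univ) (h : ∀ x, f x * g x = 0) :
    G.energy univ f g = 0 := by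
  rw [energy_univ]
  refine Finset.sum_eq_zero fun e _ => ?_
  set U : Set ℝ := Ioo 0 (G.len e) ∩ {t | f (G.edgeMap e t) ≠ 0} with hU
  have hUo : IsOpen U := isOpen_Ioo.inter (isOpen_ne_fun (continuous_edge hf e) continuous_const)
  have hfU : MemLp (G.slope f e) 2 (volume.restrict U) :=
    (memLp_slope hf e).mono_measure (Measure.restrict_mono inter_subset_left le_rfl)
  have h1 : G.slope f e =ᵐ[volume.restrict (Ioo 0 (G.len e))] U.indicator (G.slope f e) := by
    refine weakDeriv_ae_eq isOpen_Ioo ?_ (isWeakDeriv_Ioo_indicator hUo (G.len_pos e).le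
      (continuous_edge hf e).continuousOn (fun t ht htU => ?_)
      (hfU.integrableOn_Ioo inter_subset_left)
      ((isWeakDeriv_slope hf e).mono measurableSet_Ioo inter_subset_left))
    · exact ((memLp_indicator_iff_restrict hUo.measurableSet).2 hfU).mono_measure
        Measure.restrict_le_self
    · by_contra hne
      exact htU ⟨ht, hne⟩
  have h2 : G.slope g e =ᵐ[volume.restrict U] 0 := by
    refine isWeakDeriv_ae_unique hUo
      ((memLp_slope hg e).mono_measure
        (Measure.restrict_mono inter_subset_left le_rfl)).locallyIntegrableOn_two
      (MemLp.locallyIntegrableOn_two MemLp.zero)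
      ((isWeakDeriv_slope hg e).mono measurableSet_Ioo inter_subset_left) ?_
    intro φ _ _ _
    simp only [Pi.zero_apply, zero_mul, integral_zero, neg_zero]
    refine setIntegral_eq_zero_of_forall_eq_zero fun t ht => ?_
    have : g (G.edgeMap e t) = 0 := (mul_eq_zero.1 (h (G.edgeMap e t))).resolve_left ht.2
    simp [this]
  rw [Filter.EventuallyEq, ae_restrict_iff' hUo.measurableSet] at h2
  refine integral_eq_zero_of_ae ?_
  filter_upwards [h1, ae_restrict_of_ae h2] with t ht1 ht2
  by_cases htU : t ∈ U
  · simp [ht2 htU]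
  · simp [ht1, htU]

/-- The derivative of `g` vanishes almost everywhere off the part of the edges in `K`, so `f` may be
cut off to `K` even if the cut-off function is discontinuous on `G`. -/
theorem energy_indicator_left {G : MetricGraph V E} {K : Set G.Point} (hK : IsClosed K)
    {f g : G.Point → ℝ} (hf : f ∈ G.H1 univ) (hg : g ∈ G.H10 K (frontier K)) :
    G.energy K (K.indicator f) g = G.energy univ f g := by
  rw [energy_univ, energy]
  refine Finset.sum_congr rfl fun e _ => ?_
  have hU := G.isOpen_edgeDomain K e
  have e1 : ∫ t in Ioo 0 (G.len e), G.slope f e t * G.slope g e t =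
      ∫ t in Ioo 0 (G.len e), (G.edgeDomain K e).indicator (fun t => G.slope f e t *
        weakDeriv (G.edgeDomain K e) (fun t => g (G.edgeMap e t)) t) t := by
    refine integral_congr_ae ?_
    filter_upwards [(extend_mem_H1 hK hg).2 e] with t ht
    rw [ht]
    by_cases htU : t ∈ G.edgeDomain K e <;> simp [htU]
  rw [e1, setIntegral_indicator hU.measurableSet, inter_eq_right.2 (G.edgeDomain_subset K e)]
  refine integral_congr_ae ?_
  filter_upwards [(indicator_mem_H1 K hf).2 e] with t ht
  rw [ht]

theorem energy_eq_of_mem_H10 {G : MetricGraph V E} {K : Set G.Point} (hK : IsClosed K)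
    {f g : G.Point → ℝ} (hf : f ∈ G.H10 K (frontier K)) (hg : g ∈ G.H10 K (frontier K)) :
    G.energy K f g = G.energy univ f g := by
  have : K.indicator f = f := indicator_eq_self.2 fun x hx => by_contra fun h => hx (hf.1.2.1 x h)
  have h := energy_indicator_left hK (extend_mem_H1 hK hf).1 hg
  rwa [this] at h

end energy

end MetricGraph

/-- In a family of continuous functionals depending continuously on a point of a compact space,
some difference of two functionals has maximal norm. -/
theorem exists_max_functional_sub {X H : Type*} [TopologicalSpace X] [CompactSpace X] [Nonempty X]
    [NormedAddCommGroup H] [InnerProductSpace ℝ H] [CompleteSpace H] (L : X → H →L[ℝ] ℝ)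
    (hL : Continuous L) :
    ∃ x y, ∃ k : H, (∀ h, inner ℝ k h = L x h - L y h) ∧
      ∀ p q h, (L p h - L q h) ^ 2 ≤ (L x k - L y k) * inner ℝ h h := by
  -- The norm attains its maximum on the compact product. For the Riesz representative `k` of the
  -- maximal difference, `L x k - L y k` is the square of this norm.
  have hc : Continuous fun z : X × X => ‖L z.1 - L z.2‖ :=
    ((hL.comp continuous_fst).sub (hL.comp continuous_snd)).norm
  obtain ⟨⟨x, y⟩, -, hmax⟩ := isCompact_univ.exists_isMaxOn univ_nonempty hc.continuousOn
  rw [isMaxOn_iff] at hmax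
  set k := (InnerProductSpace.toDual ℝ H).symm (L x - L y) with hk
  have hkg : ∀ h, inner ℝ k h = L x h - L y h := fun h => by
    rw [hk, InnerProductSpace.toDual_symm_apply, sub_apply]
  have hkn : ‖k‖ = ‖L x - L y‖ := LinearIsometryEquiv.norm_map _ _
  refine ⟨x, y, k, hkg, fun p q h => ?_⟩
  rw [← hkg, real_inner_self_eq_norm_sq, real_inner_self_eq_norm_sq, ← mul_pow, hkn]
  have h1 : |(L p - L q) h| ≤ ‖L p - L q‖ * ‖h‖ := (L p - L q).le_opNorm h
  have h2 : ‖L p - L q‖ ≤ ‖L x - L y‖ := hmax (p, q) (mem_univ _)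
  have h3 := abs_le.1 (h1.trans (mul_le_mul_of_nonneg_right h2 (norm_nonneg h)))
  exact sq_le_sq' h3.1 h3.2

namespace MetricGraph

variable {V E : Type*}

/-! ## Effective resistance -/

theorem eq_of_eq_edges {G : MetricGraph V E} {f : G.Point → ℝ}
    (h : ∀ e, ∀ t ∈ Icc 0 (G.len e), f (G.edgeMap e t) = f (G.edgeMap e 0)) (p q : G.Point) :
    f p = f q := by
  have hstep : ∀ u v : V, (∃ e, G.src e = u ∧ G.tgt e = v) → f (G.vertex u) = f (G.vertex v) := by
    rintro u v ⟨e, rfl, rfl⟩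
    rw [← edgeMap_zero, ← edgeMap_len, h e _ (right_mem_Icc.2 (G.len_pos e).le)]
  have hv : ∀ u v : V, f (G.vertex u) = f (G.vertex v) := by
    intro u v
    induction G.connected u v with
    | rel _ _ h => exact hstep _ _ h
    | refl _ => rfl
    | symm _ _ _ ih => exact ih.symm
    | trans _ _ _ _ _ ih1 ih2 => exact ih1.trans ih2
  have hp : ∀ p : G.Point, ∃ v, f p = f (G.vertex v) := by
    intro p
    rcases G.point_cases p with ⟨v, rfl⟩ | ⟨e, t, ht, rfl⟩
    · exact ⟨v, rfl⟩
    · exact ⟨G.src e, by rw [h e t ht, edgeMap_zero]⟩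
  obtain ⟨u, hu⟩ := hp p
  obtain ⟨v, hv'⟩ := hp q
  rw [hu, hv', hv u v]

/-- Connectedness of the graph enters here: a function of `H¹(G)` is determined by its derivative up
to one global constant. -/
theorem sub_eq_sub_of_slope {G : MetricGraph V E} {f g : G.Point → ℝ} (hf : f ∈ G.H1 univ)
    (hg : g ∈ G.H1 univ)
    (h : ∀ e, G.slope f e =ᵐ[volume.restrict (Ioo 0 (G.len e))] G.slope g e) (p q : G.Point) :
    f p - f q = g p - g q := by
  have := eq_of_eq_edges (f := fun x => f x - g x) (fun e t ht => ?_) p q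
  · linarith
  have h1 := sub_eq_integral_slope hf e le_rfl ht.1 ht.2
  have h2 := sub_eq_integral_slope hg e le_rfl ht.1 ht.2
  have h3 : ∫ s in 0..t, G.slope f e s = ∫ s in 0..t, G.slope g e s := by
    rw [intervalIntegral.integral_of_le ht.1, intervalIntegral.integral_of_le ht.1,
      integral_Ioc_eq_integral_Ioo, integral_Ioc_eq_integral_Ioo]
    exact integral_congr_ae (ae_restrict_of_ae_restrict_of_subset (Ioo_subset_Ioo le_rfl ht.2) (h e))
  linarith

/-- The space of square integrable functions on the edges. -/
abbrev EdgeL2 [Fintype E] (G : MetricGraph V E) : Type _ :=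
  PiLp 2 fun e : E => Lp ℝ 2 (volume.restrict (Ioo 0 (G.len e)))

/-- The integral of a square integrable function on the edges over an initial part of an edge. -/
def edgeIntegral [Fintype E] (G : MetricGraph V E) (e : E) (t : ℝ) : G.EdgeL2 →L[ℝ] ℝ :=
  (innerSL ℝ (indicatorConstLp (μ := volume.restrict (Ioo 0 (G.len e))) 2
    (measurableSet_Iic (a := t)) (measure_ne_top _ _) (1 : ℝ))).comp
    (PiLp.proj 2 (fun e : E => Lp ℝ 2 (volume.restrict (Ioo 0 (G.len e)))) e)

theorem edgeIntegral_apply [Fintype E] (G : MetricGraph V E) (e : E) {t : ℝ}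
    (ht : t ∈ Icc 0 (G.len e)) (h : G.EdgeL2) : G.edgeIntegral e t h = ∫ s in 0..t, h e s := by
  have h1 : G.edgeIntegral e t h =
      inner ℝ (indicatorConstLp (μ := volume.restrict (Ioo 0 (G.len e))) 2
        (measurableSet_Iic (a := t)) (measure_ne_top _ _) (1 : ℝ)) (h e) := rfl
  rw [h1, L2.inner_indicatorConstLp_one, Measure.restrict_restrict measurableSet_Iic,
    intervalIntegral.integral_of_le ht.1, integral_Ioc_eq_integral_Ioo]
  refine setIntegral_congr_set ?_
  have : Iic t ∩ Ioo 0 (G.len e) = Ioc 0 t ∩ Ioo 0 (G.len e) := by ext x; simp; grind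
  rw [this]
  have h2 : (Ioo 0 (G.len e) : Set ℝ) =ᵐ[volume] Ioc 0 (G.len e) := Ioo_ae_eq_Ioc
  have h3 : (Ioc 0 t ∩ Ioo 0 (G.len e) : Set ℝ) =ᵐ[volume] (Ioc 0 t ∩ Ioc 0 (G.len e) : Set ℝ) :=
    (EventuallyEq.refl _ _).inter h2
  rw [inter_eq_left.2 (Ioc_subset_Ioc_right ht.2)] at h3
  exact h3.trans Ioo_ae_eq_Ioc.symm

theorem continuous_edgeIntegral [Fintype E] (G : MetricGraph V E) (e : E) :
    Continuous (G.edgeIntegral e) := by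
  refine Continuous.clm_comp ((innerSL ℝ).continuous.comp ?_) continuous_const
  refine continuous_indicatorConstLp_set (by norm_num) fun x => ?_
  -- Indicators of half-lines depend continuously on the endpoint in `L²`, since the symmetric
  -- difference has measure at most `|y - x|`.
  have hb : ∀ y : ℝ, volume.restrict (Ioo 0 (G.len e)) (symmDiff (Iic y) (Iic x)) ≤
      ENNReal.ofReal |y - x| := by
    intro y
    refine (Measure.restrict_apply_le _ _).trans ?_
    have : symmDiff (Iic y) (Iic x) ⊆ uIoc x y := by
      intro z hz
      rw [mem_symmDiff] at hz
      simp only [mem_Iic, not_le] at hz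
      rw [mem_uIoc]
      tauto
    refine (measure_mono this).trans_eq ?_
    rw [uIoc, Real.volume_Ioc, max_sub_min_eq_abs]
  refine tendsto_of_tendsto_of_tendsto_of_le_of_le tendsto_const_nhds ?_ (fun _ => zero_le) hb
  have : Tendsto (fun y : ℝ => ENNReal.ofReal |y - x|) (𝓝 x) (𝓝 (ENNReal.ofReal |x - x|)) :=
    (ENNReal.continuous_ofReal.comp (continuous_id.sub continuous_const).abs).tendsto x
  simpa using this

/-- The differences of a function on the vertices along the edges. -/
def coboundary (G : MetricGraph V E) : (V → ℝ) →ₗ[ℝ] (E → ℝ) where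
  toFun v e := v (G.tgt e) - v (G.src e)
  map_add' u v := by ext e; simp only [Pi.add_apply]; ring
  map_smul' c v := by ext e; simp only [Pi.smul_apply, smul_eq_mul, RingHom.id_apply]; ring

/-- The increments along the edges of a primitive of a square integrable function. -/
def increments [Fintype E] (G : MetricGraph V E) : G.EdgeL2 →L[ℝ] (E → ℝ) :=
  ContinuousLinearMap.pi fun e => G.edgeIntegral e (G.len e)

/-- A linear choice of vertex values for consistent edge increments; it fixes the free additive
constant linearly. -/
theorem exists_coboundary_inverse [Fintype E] (G : MetricGraph V E) :
    ∃ s : (E → ℝ) →ₗ[ℝ] (V → ℝ), ∀ w ∈ LinearMap.range G.coboundary, G.coboundary (s w) = w := by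
  obtain ⟨r, hr⟩ := G.coboundary.rangeRestrict.exists_rightInverse_of_surjective
    G.coboundary.range_rangeRestrict
  obtain ⟨s, hs⟩ := r.exists_extend
  refine ⟨s, fun w hw => ?_⟩
  have h1 : s w = r ⟨w, hw⟩ := LinearMap.congr_fun hs ⟨w, hw⟩
  have h2 := LinearMap.congr_fun hr ⟨w, hw⟩
  rw [h1]
  exact congrArg Subtype.val h2

/-- The derivatives of functions in `H¹(G)` form a closed subspace of the square integrable
functions on the edges; evaluation at a point is a continuous functional on it which depends
continuously on the point. -/
theorem exists_evaluation [Finite V] [Fintype E] (G : MetricGraph V E) :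
    ∃ (W : Submodule ℝ G.EdgeL2) (L : G.Point → W →L[ℝ] ℝ), IsClosed (W : Set G.EdgeL2) ∧
      Continuous L ∧
      (∀ h : W, (fun p => L p h) ∈ G.H1 univ ∧ ∀ e, G.slope (fun p => L p h) e
        =ᵐ[volume.restrict (Ioo 0 (G.len e))] (h : G.EdgeL2) e) ∧
      ∀ g ∈ G.H1 univ, ∃ h : W, ∀ e, G.slope g e
        =ᵐ[volume.restrict (Ioo 0 (G.len e))] (h : G.EdgeL2) e := by
  have := Fintype.ofFinite V
  obtain ⟨s, hs⟩ := G.exists_coboundary_inverse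
  -- A square integrable function on the edges is a derivative on the graph exactly when its
  -- increments are differences of vertex values. The range of the coboundary is finite-dimensional,
  -- which makes `W` closed.
  set W : Submodule ℝ G.EdgeL2 :=
    (LinearMap.range G.coboundary).comap G.increments.toLinearMap with hW
  have hmem : ∀ h : G.EdgeL2, h ∈ W ↔ G.increments h ∈ LinearMap.range G.coboundary := fun h =>
    Iff.rfl
  set S : G.EdgeL2 →L[ℝ] (V → ℝ) := (LinearMap.toContinuousLinearMap s).comp G.increments with hS
  have hSd : ∀ h ∈ W, ∀ e, S h (G.tgt e) - S h (G.src e) = G.edgeIntegral e (G.len e) h :=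
    fun h hh e => congrFun (hs _ ((hmem h).1 hh)) e
  let A : V → G.EdgeL2 →L[ℝ] ℝ := fun v => (ContinuousLinearMap.proj v).comp S
  -- The value on an edge is the value at its source plus the integral from there; consistency at
  -- the target is `hSd`.
  let L : G.Point → W →L[ℝ] ℝ := Quot.lift
    (Sum.elim (fun v => (A v).comp W.subtypeL)
      fun z => (A (G.src z.1) + G.edgeIntegral z.1 z.2).comp W.subtypeL) (by
    rintro _ _ (e | e)
    · ext h
      have h0 : G.edgeIntegral e 0 (h : G.EdgeL2) = 0 := by
        rw [edgeIntegral_apply G e (left_mem_Icc.2 (G.len_pos e).le)]; simp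
      change S h (G.src e) + G.edgeIntegral e 0 (h : G.EdgeL2) = S h (G.src e)
      rw [h0, add_zero]
    · ext h
      change S h (G.src e) + G.edgeIntegral e (G.len e) (h : G.EdgeL2) = S h (G.tgt e)
      rw [← hSd h h.2 e]; ring)
  have hLe : ∀ e, ∀ t ∈ Icc 0 (G.len e), L (G.edgeMap e t) =
      (A (G.src e) + G.edgeIntegral e t).comp W.subtypeL := by
    intro e t ht
    change (A (G.src e) + G.edgeIntegral e (projIcc 0 (G.len e) (G.len_pos e).le t)).comp
      W.subtypeL = _
    rw [projIcc_of_mem _ ht]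
  have hLc : Continuous L := by
    refine G.continuous_of_edges fun e => ?_
    refine ContinuousOn.congr (Continuous.continuousOn ?_) (hLe e)
    exact (continuous_const.add (G.continuous_edgeIntegral e)).clm_comp continuous_const
  refine ⟨W, L, ?_, hLc, fun h => ?_, fun g hg => ?_⟩
  · exact (Submodule.closed_of_finiteDimensional (LinearMap.range G.coboundary)).preimage
      G.increments.continuous
  · refine mem_H1_univ_of_eq_integral (hLc.clm_apply continuous_const)
      (fun e => Lp.memLp ((h : G.EdgeL2) e)) fun e t ht => ?_
    rw [hLe e t ht, hLe e 0 (left_mem_Icc.2 (G.len_pos e).le), ← edgeIntegral_apply G e ht]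
    have h0 : G.edgeIntegral e 0 (h : G.EdgeL2) = 0 := by
      rw [edgeIntegral_apply G e (left_mem_Icc.2 (G.len_pos e).le)]; simp
    simp [h0]
  · let h : G.EdgeL2 := WithLp.toLp 2 fun e => (memLp_slope hg e).toLp _
    have hh : ∀ e, h e =ᵐ[volume.restrict (Ioo 0 (G.len e))] G.slope g e :=
      fun e => MemLp.coeFn_toLp (memLp_slope hg e)
    refine ⟨⟨h, (hmem h).2 ⟨fun v => g (G.vertex v), ?_⟩⟩, fun e => (hh e).symm⟩
    ext e
    change g (G.vertex (G.tgt e)) - g (G.vertex (G.src e)) = G.edgeIntegral e (G.len e) h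
    have hl := (G.len_pos e).le
    rw [← edgeMap_zero, ← edgeMap_len, sub_eq_integral_slope hg e le_rfl hl le_rfl,
      edgeIntegral_apply G e (right_mem_Icc.2 hl), intervalIntegral.integral_of_le hl,
      intervalIntegral.integral_of_le hl, integral_Ioc_eq_integral_Ioo,
      integral_Ioc_eq_integral_Ioo]
    exact (integral_congr_ae (hh e)).symm

/-- There are two points of maximal effective resistance `k x - k y`, with a potential `k` for
the unit flow between them. -/
theorem exists_max_resistance [Finite V] [Fintype E] (G : MetricGraph V E) :
    ∃ x y : G.Point, ∃ k ∈ G.H1 univ, (∀ g ∈ G.H1 univ, G.energy univ k g = g x - g y) ∧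
      ∀ g ∈ G.H1 univ, ∀ p q, (g p - g q) ^ 2 ≤ (k x - k y) * G.energy univ g g := by
  obtain ⟨W, L, hWc, hLc, hLW, hWL⟩ := G.exists_evaluation
  have : CompactSpace G.Point := G.compactSpace_point
  have : Nonempty G.Point := G.nonempty_point
  have : CompleteSpace W := hWc.completeSpace_coe
  obtain ⟨x, y, k, hkg, hmax⟩ := exists_max_functional_sub L hLc
  have henergy : ∀ f ∈ G.H1 univ, ∀ g ∈ G.H1 univ, ∀ h h' : W,
      (∀ e, G.slope f e =ᵐ[volume.restrict (Ioo 0 (G.len e))] (h : G.EdgeL2) e) →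
      (∀ e, G.slope g e =ᵐ[volume.restrict (Ioo 0 (G.len e))] (h' : G.EdgeL2) e) →
      G.energy univ f g = inner ℝ h h' := by
    intro f _ g _ h h' hfh hgh
    rw [energy_univ, Submodule.coe_inner, PiLp.inner_apply]
    refine Finset.sum_congr rfl fun e _ => ?_
    rw [L2.inner_def]
    refine integral_congr_ae ?_
    filter_upwards [hfh e, hgh e] with t h1 h2
    rw [h1, h2]
    simp [mul_comm]
  have hdiff : ∀ g ∈ G.H1 univ, ∀ h : W,
      (∀ e, G.slope g e =ᵐ[volume.restrict (Ioo 0 (G.len e))] (h : G.EdgeL2) e) →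
      ∀ p q, g p - g q = L p h - L q h := fun g hg h hgh =>
    sub_eq_sub_of_slope hg (hLW h).1 fun e => (hgh e).trans ((hLW h).2 e).symm
  refine ⟨x, y, fun p => L p k, (hLW k).1, fun g hg => ?_, fun g hg p q => ?_⟩
  · obtain ⟨h, hgh⟩ := hWL g hg
    rw [henergy _ (hLW k).1 g hg k h (hLW k).2 hgh, hkg, hdiff g hg h hgh]
  · obtain ⟨h, hgh⟩ := hWL g hg
    rw [hdiff g hg h hgh, henergy g hg g hg h h hgh hgh]
    exact hmax p q h

end MetricGraph

/-- First variation at a maximum. The choice `ε = a / (|b| + 1)` is small enough for the linear term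
to dominate, which makes the expression positive unless `a = 0`. -/
theorem eq_zero_of_forall_two_mul_add_sq_mul_nonpos {a b : ℝ}
    (h : ∀ ε : ℝ, 2 * ε * a + ε ^ 2 * b ≤ 0) : a = 0 := by
  have h1 := h (a / (|b| + 1))
  have hb : 0 < |b| + 1 := by positivity
  have e : 2 * (a / (|b| + 1)) * a + (a / (|b| + 1)) ^ 2 * b =
      a ^ 2 * (2 * (|b| + 1) + b) / (|b| + 1) ^ 2 := by field_simp
  rw [e] at h1
  by_contra hne
  have : 0 < a ^ 2 * (2 * (|b| + 1) + b) / (|b| + 1) ^ 2 := by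
    have := neg_abs_le b
    have h2 : 0 < 2 * (|b| + 1) + b := by linarith [abs_nonneg b]
    positivity
  linarith

namespace MetricGraph

variable {V E : Type*}

/-! ## Eigenvalues -/

theorem continuous_of_mem_H1 {G : MetricGraph V E} {f : G.Point → ℝ} (hf : f ∈ G.H1 univ) :
    Continuous f := (mem_H1_univ.1 hf).1

theorem integrable_of_continuous [Finite V] [Finite E] {G : MetricGraph V E} {f : G.Point → ℝ}
    (hf : Continuous f) (μ : Measure G.Point) [IsFiniteMeasure μ] : Integrable f μ := by
  have := G.compactSpace_point
  obtain ⟨C, hC⟩ := isCompact_univ.exists_bound_of_continuousOn hf.continuousOn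
  exact Integrable.of_bound hf.aestronglyMeasurable C (ae_of_all _ fun x => hC x (mem_univ x))

theorem memLp_of_continuous [Finite V] [Finite E] {G : MetricGraph V E} {f : G.Point → ℝ}
    (hf : Continuous f) (μ : Measure G.Point) [IsFiniteMeasure μ] : MemLp f 2 μ := by
  have := G.compactSpace_point
  obtain ⟨C, hC⟩ := isCompact_univ.exists_bound_of_continuousOn hf.continuousOn
  exact MemLp.of_bound hf.aestronglyMeasurable C (ae_of_all _ fun x => hC x (mem_univ x))

section eigenvalue

variable [Fintype E]

theorem const_mem_formDomain (G : MetricGraph V E) (μ : Measure G.Point) (c : ℝ) :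
    (fun _ => c) ∈ G.formDomain univ ∅ μ :=
  ⟨⟨G.const_mem_H1 c, fun _ h => h.elim⟩, fun g _ _ => by
    rw [energy_comm, energy_const_right]⟩

theorem IsEigenfunction.mem_H1 {G : MetricGraph V E} {K A : Set G.Point} {μ : Measure G.Point}
    {t : ℝ} {f : G.Point → ℝ} (h : G.IsEigenfunction K A μ t f) : f ∈ G.H1 K := h.2.1.1.1

theorem IsEigenfunction.energy_self {G : MetricGraph V E} {K A : Set G.Point}
    {μ : Measure G.Point} {t : ℝ} {f : G.Point → ℝ} (h : G.IsEigenfunction K A μ t f) :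
    G.energy K f f = t * ∫ x, f x ^ 2 ∂μ := by
  rw [h.2.2.2 f h.2.1, ← integral_const_mul]
  exact integral_congr_ae (ae_of_all _ fun x => by ring)

theorem IsEigenfunction.mul_integral_eq_zero {G : MetricGraph V E} {μ : Measure G.Point}
    {t : ℝ} {f : G.Point → ℝ} (h : G.IsEigenfunction univ ∅ μ t f) : t * ∫ x, f x ∂μ = 0 := by
  have := h.2.2.2 _ (G.const_mem_formDomain μ 1)
  rw [energy_const_right] at this
  simpa [integral_const_mul] using this.symm

theorem isEigenfunction_const (G : MetricGraph V E) (μ : Measure G.Point) :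
    G.IsEigenfunction univ ∅ μ 0 (fun _ => 1) := by
  refine ⟨fun h => ?_, G.const_mem_formDomain μ 1, by simp, fun φ _ => ?_⟩
  · obtain ⟨x⟩ := G.nonempty_point
    simpa using congrFun h x
  · rw [energy_comm, energy_const_right]; simp

theorem exists_isEigenfunction_of_one_le_rank {G : MetricGraph V E} {K A : Set G.Point}
    {μ : Measure G.Point} {s : ℝ≥0} (h : ((0 : ℕ) : Cardinal) + 1 ≤ Module.rank ℝ
      (Submodule.span ℝ {f | ∃ t : ℝ, t ≤ s ∧ G.IsEigenfunction K A μ t f})) :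
    ∃ f : G.Point → ℝ, ∃ t : ℝ, t ≤ s ∧ G.IsEigenfunction K A μ t f := by
  by_contra hne
  have : {f | ∃ t : ℝ, t ≤ s ∧ G.IsEigenfunction K A μ t f} = ∅ :=
    eq_empty_of_forall_notMem fun f hf => hne ⟨f, hf⟩
  rw [this, Submodule.span_empty] at h
  simp at h

theorem eigenvalue_zero_le {G : MetricGraph V E} {K A : Set G.Point} {μ : Measure G.Point}
    {t : ℝ≥0} {f : G.Point → ℝ} (h : G.IsEigenfunction K A μ t f) :
    G.eigenvalue K A μ 0 ≤ t := by
  refine iInf₂_le_of_le t ?_ le_rfl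
  have : Nontrivial (Submodule.span ℝ {f | ∃ s : ℝ, s ≤ t ∧ G.IsEigenfunction K A μ s f}) :=
    (Submodule.nontrivial_iff_ne_bot).2 fun hb =>
      h.1 ((Submodule.eq_bot_iff _).1 hb f (Submodule.subset_span ⟨t, le_rfl, h⟩))
  simpa [Cardinal.one_le_iff_pos] using rank_pos_iff_nontrivial.2 this

/-- Constant eigenfunctions alone span at most a line, so rank two requires a nonconstant one. -/
theorem exists_isEigenfunction_of_two_le_rank {G : MetricGraph V E} {μ : Measure G.Point}
    {s : ℝ≥0} (h : ((1 : ℕ) : Cardinal) + 1 ≤ Module.rank ℝ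
      (Submodule.span ℝ {f | ∃ t : ℝ, t ≤ s ∧ G.IsEigenfunction univ ∅ μ t f})) :
    ∃ f : G.Point → ℝ, ∃ t : ℝ, t ≤ s ∧ G.IsEigenfunction univ ∅ μ t f ∧
      ∃ p q, f p ≠ f q := by
  by_contra! hne
  obtain ⟨x⟩ := G.nonempty_point
  have h1 : Module.rank ℝ
      (Submodule.span ℝ {f | ∃ t : ℝ, t ≤ s ∧ G.IsEigenfunction univ ∅ μ t f}) ≤ 1 := by
    rw [rank_submodule_le_one_iff']
    refine ⟨fun _ => 1, Submodule.span_le.2 ?_⟩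
    rintro f ⟨t, hts, hf⟩
    refine Submodule.mem_span_singleton.2 ⟨f x, ?_⟩
    ext y
    simp [hne f t hts hf y x]
  have h2 := h.trans h1
  rw [Nat.cast_one, one_add_one_eq_two] at h2
  exact absurd h2 (not_le.2 Cardinal.one_lt_two)

/-- The constant `1`, with eigenvalue `0`, and a nonconstant `f` cannot lie on one line. -/
theorem lambda1_le {G : MetricGraph V E} {μ : Measure G.Point} {t : ℝ≥0} {f : G.Point → ℝ}
    (h : G.IsEigenfunction univ ∅ μ t f) {p q : G.Point} (hpq : f p ≠ f q) :
    G.lambda1 μ ≤ t := by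
  refine iInf₂_le_of_le t ?_ le_rfl
  rw [Cardinal.natCast_add_one_le_iff, Nat.cast_one, ← not_le,
    rank_submodule_le_one_iff']
  rintro ⟨v, hv⟩
  obtain ⟨a, ha⟩ := Submodule.mem_span_singleton.1
    (hv (Submodule.subset_span ⟨t, le_rfl, h⟩))
  obtain ⟨b, hb⟩ := Submodule.mem_span_singleton.1
    (hv (Submodule.subset_span ⟨0, t.2, G.isEigenfunction_const μ⟩))
  have h1 := congrFun hb p
  have h2 := congrFun hb q
  have h3 := congrFun ha p
  have h4 := congrFun ha q
  simp only [Pi.smul_apply, smul_eq_mul] at h1 h2 h3 h4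
  have hb0 : b ≠ 0 := by rintro rfl; simp at h1
  have : v p = v q := mul_left_cancel₀ hb0 (h1.trans h2.symm)
  exact hpq (by rw [← h3, ← h4, this])

/-- The chain `(f p - f q)² ≤ R q(f, f) ≤ R t (-(f p * f q)) ≤ R t (f p - f q)² / 4`. The middle
bound is kept in the conclusion because the equality case needs it. -/
theorem IsEigenfunction.extremal_values [Finite V] {G : MetricGraph V E} {R : ℝ}
    (hR : ∀ g ∈ G.H1 univ, ∀ p q, (g p - g q) ^ 2 ≤ R * G.energy univ g g) (hR0 : 0 ≤ R)
    {μ : Measure G.Point} [IsProbabilityMeasure μ] {t : ℝ} {f : G.Point → ℝ}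
    (h : G.IsEigenfunction univ ∅ μ t f) {p q : G.Point} (hp : ∀ x, f x ≤ f p)
    (hq : ∀ x, f q ≤ f x) (hpq : f q < f p) :
    0 < t ∧ G.energy univ f f ≤ t * (-(f p * f q)) ∧ 4 ≤ R * t := by
  have hf := h.mem_H1
  have hc := continuous_of_mem_H1 hf
  have hi1 := integrable_of_continuous hc μ
  have hi2 := integrable_of_continuous (hc.pow 2) μ
  have hb := hR f hf p q
  have hpos : 0 < (f p - f q) ^ 2 := pow_pos (sub_pos.2 hpq) 2
  have hen : 0 < G.energy univ f f := by
    by_contra hcon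
    have := mul_nonpos_of_nonneg_of_nonpos hR0 (not_lt.1 hcon)
    linarith
  have he := h.energy_self
  have hsq : 0 ≤ ∫ x, f x ^ 2 ∂μ := integral_nonneg fun x => sq_nonneg _
  have ht : 0 < t := by
    by_contra hcon
    have := mul_nonpos_of_nonpos_of_nonneg (not_lt.1 hcon) hsq
    linarith
  have h0 : ∫ x, f x ∂μ = 0 := (mul_eq_zero.1 h.mul_integral_eq_zero).resolve_left ht.ne'
  have hle : ∫ x, f x ^ 2 ∂μ ≤ -(f p * f q) := by
    -- The integrand bounds `f²` from above, by `(f p - f)(f - f q) ≥ 0`; its linear part integrates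
    -- to zero.
    have e1 : ∫ x, ((f p + f q) * f x - f p * f q) ∂μ = -(f p * f q) := by
      rw [integral_sub (hi1.const_mul _) (integrable_const _), integral_const_mul, h0]
      simp
    rw [← e1]
    refine integral_mono hi2 ((hi1.const_mul _).sub (integrable_const _)) fun x => ?_
    have := mul_nonneg (sub_nonneg.2 (hp x)) (sub_nonneg.2 (hq x))
    simp only
    linarith [this]
  have hle2 : G.energy univ f f ≤ t * (-(f p * f q)) := by
    rw [he]; exact mul_le_mul_of_nonneg_left hle ht.le
  refine ⟨ht, hle2, ?_⟩
  have h1 : (f p - f q) ^ 2 ≤ R * (t * ((f p - f q) ^ 2 / 4)) := by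
    refine hb.trans (mul_le_mul_of_nonneg_left (hle2.trans
      (mul_le_mul_of_nonneg_left ?_ ht.le)) hR0)
    nlinarith [sq_nonneg (f p + f q)]
  by_contra hcon
  nlinarith [mul_pos hpos (sub_pos.2 (not_le.1 hcon))]

theorem exists_extremal_points [Finite V] {G : MetricGraph V E} {f : G.Point → ℝ}
    (hf : Continuous f) : ∃ p q, (∀ x, f x ≤ f p) ∧ ∀ x, f q ≤ f x := by
  have := G.compactSpace_point
  have := G.nonempty_point
  obtain ⟨p, -, hp⟩ := isCompact_univ.exists_isMaxOn univ_nonempty hf.continuousOn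
  obtain ⟨q, -, hq⟩ := isCompact_univ.exists_isMinOn univ_nonempty hf.continuousOn
  exact ⟨p, q, fun x => hp (mem_univ x), fun x => hq (mem_univ x)⟩

theorem four_div_le_of_four_le {R : ℝ} {s : ℝ≥0} (hR0 : 0 ≤ R) (h : 4 ≤ R * s) :
    4 / ENNReal.ofReal R ≤ s := by
  refine ENNReal.div_le_of_le_mul' ?_
  rw [← ENNReal.ofReal_coe_nnreal, ← ENNReal.ofReal_mul hR0,
    show (4 : ℝ≥0∞) = ENNReal.ofReal 4 by simp]
  exact ENNReal.ofReal_le_ofReal h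

theorem le_lambda1 [Finite V] {G : MetricGraph V E} {R : ℝ}
    (hR : ∀ g ∈ G.H1 univ, ∀ p q, (g p - g q) ^ 2 ≤ R * G.energy univ g g) (hR0 : 0 ≤ R)
    (μ : Measure G.Point) [IsProbabilityMeasure μ] : 4 / ENNReal.ofReal R ≤ G.lambda1 μ := by
  refine le_iInf₂ fun s hs => ?_
  obtain ⟨f, t, hts, hf, a, b, hab⟩ := exists_isEigenfunction_of_two_le_rank hs
  obtain ⟨p, q, hp, hq⟩ := exists_extremal_points (continuous_of_mem_H1 hf.mem_H1)
  have hpq : f q < f p := by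
    rcases lt_or_gt_of_ne hab with h | h
    · exact (hq a).trans_lt (h.trans_le (hp b))
    · exact (hq b).trans_lt (h.trans_le (hp a))
  have := (hf.extremal_values hR hR0 hp hq hpq).2.2
  exact four_div_le_of_four_le hR0 (this.trans (mul_le_mul_of_nonneg_left hts hR0))

theorem mem_support_of_le {X : Type*} [TopologicalSpace X] [MeasurableSpace X] {μ : Measure X}
    {c : ℝ≥0∞} (hc : c ≠ 0) {x : X} (h : c • Measure.dirac x ≤ μ) : x ∈ μ.support := by
  rw [Measure.mem_support_iff_forall]
  intro U hU
  refine lt_of_lt_of_le ?_ (h U)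
  simp [Measure.dirac_apply_of_mem (mem_of_mem_nhds hU), pos_iff_ne_zero, hc]

theorem exists_isEigenfunction_of_potential [Finite V] {G : MetricGraph V E} {x y : G.Point} {k : G.Point → ℝ}
    (hk : k ∈ G.H1 univ) (hkg : ∀ g ∈ G.H1 univ, G.energy univ k g = g x - g y)
    (hpos : 0 < k x - k y) : ∃ μ : Measure G.Point, ∃ f : G.Point → ℝ, IsProbabilityMeasure μ ∧
      G.IsEigenfunction univ ∅ μ (4 / (k x - k y)) f ∧ f x ≠ f y := by
  set μ : Measure G.Point := (2⁻¹ : ℝ≥0∞) • Measure.dirac x + (2⁻¹ : ℝ≥0∞) • Measure.dirac y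
    with hμ
  have hprob : IsProbabilityMeasure μ := ⟨by simp [hμ, ENNReal.inv_two_add_inv_two]⟩
  set R := k x - k y with hR
  -- Centring gives the values `±R/2` at `x` and `y`, hence mean zero. With masses `1/2` the
  -- eigenvalue must satisfy `t * (1/2) * (R/2) = 1`, so `t = 4 / R`.
  set f : G.Point → ℝ := fun p => k p + -((k x + k y) / 2) with hf
  have hfH : f ∈ G.H1 univ := add_const_mem_H1 hk _
  have hfg : ∀ g ∈ G.H1 univ, G.energy univ f g = g x - g y := fun g hg => by
    rw [hf, energy_add_const_left hk hg, hkg g hg]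
  have hx : f x = R / 2 := by simp only [hf, hR]; ring
  have hy : f y = -(R / 2) := by simp only [hf, hR]; ring
  have hxs : x ∈ μ.support :=
    mem_support_of_le (c := 2⁻¹) (by simp) (Measure.le_add_right le_rfl)
  have hys : y ∈ μ.support :=
    mem_support_of_le (c := 2⁻¹) (by simp) (Measure.le_add_left le_rfl)
  have hfin : ∀ z : G.Point, IsFiniteMeasure ((2⁻¹ : ℝ≥0∞) • Measure.dirac z) := fun z =>
    Measure.smul_finite _ (by simp)
  refine ⟨μ, f, hprob, ⟨fun h => ?_, ⟨⟨hfH, fun _ h => h.elim⟩, fun g hg hg0 => ?_⟩,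
    memLp_of_continuous (continuous_const.mul (continuous_of_mem_H1 hfH)) μ, fun φ hφ => ?_⟩, ?_⟩
  · rw [h] at hx
    simp only [Pi.zero_apply] at hx
    linarith
  · rw [hfg g hg, hg0 x (by simp [hxs]), hg0 y (by simp [hys]), sub_zero]
  · have hc : Continuous fun z => 4 / R * f z * φ z :=
      (continuous_const.mul (continuous_of_mem_H1 hfH)).mul (continuous_of_mem_H1 hφ.1.1)
    rw [hfg φ hφ.1.1, hμ, integral_add_measure (integrable_of_continuous hc _)
      (integrable_of_continuous hc _), integral_smul_measure, integral_smul_measure,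
      integral_dirac' _ _ hc.stronglyMeasurable, integral_dirac' _ _ hc.stronglyMeasurable, hx, hy]
    simp only [ENNReal.toReal_inv, ENNReal.toReal_ofNat, smul_eq_mul]
    field_simp
    ring
  · rw [hx, hy]
    intro h
    linarith

theorem ofReal_four_div {R : ℝ} (hR : 0 < R) :
    ((Real.toNNReal (4 / R) : ℝ≥0) : ℝ≥0∞) = 4 / ENNReal.ofReal R := by
  change ENNReal.ofReal (4 / R) = _
  rw [ENNReal.ofReal_div_of_pos hR]
  simp

/-! ## Weighted partitions -/

/-- Since `μ` has mass one, the energy `t ∫ f² dμ` is at most `s` times the maximum of `f²`;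
dividing by the value of `f` where `|f|` is maximal removes all dependence on `μ`. -/
theorem IsEigenfunction.exists_normalized [Finite V] {G : MetricGraph V E} {K : Set G.Point}
    (hK : IsClosed K) {μ : Measure G.Point} [IsProbabilityMeasure μ] {t : ℝ} {s : ℝ≥0}
    (hts : t ≤ s) {f : G.Point → ℝ} (h : G.IsEigenfunction K (frontier K) μ t f) :
    ∃ φ ∈ G.H1 univ, (∀ x ∉ interior K, φ x = 0) ∧ (∃ x, φ x = 1) ∧
      G.energy univ φ φ ≤ s := by
  have := G.compactSpace_point
  have := G.nonempty_point
  have hf10 : f ∈ G.H10 K (frontier K) := h.2.1.1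
  have hf := (extend_mem_H1 hK hf10).1
  have hc := continuous_of_mem_H1 hf
  obtain ⟨x, -, hx⟩ := isCompact_univ.exists_isMaxOn univ_nonempty hc.abs.continuousOn
  have hx : ∀ y, |f y| ≤ |f x| := fun y => hx (mem_univ y)
  have hfx : f x ≠ 0 := fun h0 => h.1 <| funext fun y => by
    have := hx y
    rw [h0, abs_zero] at this
    exact abs_nonpos_iff.1 this
  have he : G.energy univ f f ≤ s * f x ^ 2 := by
    rw [← energy_eq_of_mem_H10 hK hf10 hf10, h.energy_self, ← integral_const_mul]
    have hi := (integrable_of_continuous (hc.pow 2) μ).const_mul t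
    refine (integral_mono hi (integrable_const (s * f x ^ 2)) fun y => ?_).trans_eq (by simp)
    exact mul_le_mul hts (sq_le_sq.2 (hx y)) (sq_nonneg _) s.2
  refine ⟨fun y => (f x)⁻¹ * f y, mul_mem_H1 hf _, fun y hy => ?_, ⟨x, inv_mul_cancel₀ hfx⟩, ?_⟩
  · have : f y = 0 := by
      by_cases hyK : y ∈ K
      · exact hf10.2 y ⟨subset_closure hyK, hy⟩
      · exact hf10.1.2.1 y hyK
    simp [this]
  · rw [energy_mul_left hf (mul_mem_H1 hf _), energy_mul_right hf hf]
    calc (f x)⁻¹ * ((f x)⁻¹ * G.energy univ f f) = G.energy univ f f / f x ^ 2 := by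
          field_simp
      _ ≤ s := (div_le_iff₀ (by positivity)).2 he

theorem exists_of_dirichletMin_lt [Finite V] {G : MetricGraph V E} {K : Set G.Point}
    (hK : IsClosed K) {c : ℝ≥0∞} (h : G.dirichletMin K (frontier K) < c) :
    ∃ s : ℝ≥0, (s : ℝ≥0∞) < c ∧ ∃ φ ∈ G.H1 univ, (∀ x ∉ interior K, φ x = 0) ∧
      (∃ x, φ x = 1) ∧ G.energy univ φ φ ≤ s := by
  simp only [dirichletMin, eigenvalue, iInf_lt_iff] at h
  obtain ⟨μ, ⟨hμ, -, -⟩, s, hs, hsc⟩ := h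
  obtain ⟨f, t, hts, hf⟩ := exists_isEigenfunction_of_one_le_rank hs
  exact ⟨s, hsc, hf.exists_normalized hK hts⟩

theorem le_dirichletEnergy [Finite V] {G : MetricGraph V E} {R : ℝ}
    (hR : ∀ g ∈ G.H1 univ, ∀ p q, (g p - g q) ^ 2 ≤ R * G.energy univ g g) (hR0 : 0 ≤ R)
    (P : G.WeightedPartition 2) : 4 / ENNReal.ofReal R ≤ P.dirichletEnergy := by
  by_contra hcon
  obtain ⟨c, hc1, hc2⟩ := ENNReal.lt_iff_exists_nnreal_btwn.1 (not_le.1 hcon)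
  have key : ∀ i, ∃ φ ∈ G.H1 univ, (∀ x ∉ interior (P.piece i), φ x = 0) ∧
      (∃ x, φ x = 1) ∧ G.energy univ φ φ ≤ P.weight i * c := by
    intro i
    have hw := P.weight_pos i
    have h1 : ENNReal.ofReal (1 / P.weight i) *
        G.dirichletMin (P.piece i) (frontier (P.piece i)) < c :=
      (le_iSup (fun i => ENNReal.ofReal (1 / P.weight i) *
        G.dirichletMin (P.piece i) (frontier (P.piece i))) i).trans_lt hc1
    have h2 : G.dirichletMin (P.piece i) (frontier (P.piece i)) <
        ENNReal.ofReal (P.weight i * c) := by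
      rw [ENNReal.ofReal_div_of_pos hw, ENNReal.ofReal_one, one_div, mul_comm,
        ← div_eq_mul_inv, ENNReal.div_lt_iff (Or.inl (by simpa using hw))
          (Or.inl ENNReal.ofReal_ne_top)] at h1
      rwa [mul_comm, ENNReal.ofReal_mul c.coe_nonneg, ENNReal.ofReal_coe_nnreal]
    obtain ⟨s, hs, φ, hφ, h0, h1, he⟩ := exists_of_dirichletMin_lt (P.isClosed_piece i) h2
    refine ⟨φ, hφ, h0, h1, he.trans ?_⟩
    rw [← ENNReal.ofReal_coe_nnreal] at hs
    exact ((ENNReal.ofReal_lt_ofReal_iff_of_nonneg s.2).1 hs).le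
  obtain ⟨φ, hφ, hφ0, ⟨x, hx⟩, heφ⟩ := key 0
  obtain ⟨ψ, hψ, hψ0, ⟨y, hy⟩, heψ⟩ := key 1
  have hdisj := disjoint_left.1 (P.disjoint_interior 0 1 (by decide))
  have hprod : ∀ z, φ z * ψ z = 0 := fun z => by
    by_cases hz : z ∈ interior (P.piece 0)
    · rw [hψ0 z (hdisj hz), mul_zero]
    · rw [hφ0 z hz, zero_mul]
  have hxψ : ψ x = 0 := by simpa [hx] using hprod x
  have hyφ : φ y = 0 := by simpa [hy] using hprod y
  -- `φ - ψ` equals `1` at `x` and `-1` at `y`, and its energy has no mixed term: `4 ≤ R (q(φ, φ) +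
  -- q(ψ, ψ)) ≤ R c`.
  have hb := hR _ (add_mul_mem_H1 hφ hψ (-1)) x y
  rw [energy_add_mul_self hφ hψ, energy_eq_zero_of_mul_eq_zero hφ hψ hprod, hx, hy, hxψ, hyφ] at hb
  have hsum := P.sum_weight
  rw [Fin.sum_univ_two] at hsum
  have : (4 : ℝ) ≤ R * c := by
    refine le_trans ?_ (mul_le_mul_of_nonneg_left (show G.energy univ φ φ + G.energy univ ψ ψ ≤ c
      from (add_le_add heφ heψ).trans_eq (by rw [← add_mul, hsum, one_mul])) hR0)
    linarith
  exact absurd (four_div_le_of_four_le hR0 this) (not_le.2 hc2)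

/-! ## Nodal domains -/

theorem nodalDomain_subset {X : Type*} [TopologicalSpace X] {f : X → ℝ} (hf : Continuous f) :
    closure {x | 0 < f x} ⊆ {x | 0 ≤ f x} :=
  closure_minimal (ofPred_subset_ofPred.2 fun _ hx => le_of_lt hx) (isClosed_le continuous_const hf)

theorem disjoint_interior_nodalDomains {X : Type*} [TopologicalSpace X] {f : X → ℝ}
    (hf : Continuous f) :
    Disjoint (interior (closure {x | 0 < f x})) (interior (closure {x | f x < 0})) := by
  rw [disjoint_left]
  intro x hx hx'
  obtain ⟨y, ⟨hy1, hy2⟩, hy3⟩ := mem_closure_iff.1 (interior_subset hx)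
    (interior (closure {x | 0 < f x}) ∩ interior (closure {x | f x < 0}))
    (isOpen_interior.inter isOpen_interior) ⟨hx, hx'⟩
  have : closure {x | f x < 0} ⊆ {x | f x ≤ 0} :=
    closure_minimal (ofPred_subset_ofPred.2 fun _ hx => le_of_lt hx) (isClosed_le hf continuous_const)
  exact absurd (show f y ≤ 0 from this (interior_subset hy2)) (not_le.2 hy3)

/-- The flow has its source at `p` and its sink at `q`, where `f < 0`. On a relatively clopen part
of the nodal domain missing `p`, the cut-off of `f` has zero energy and vanishes at `q`; so it is
zero, and the part is empty. -/
theorem isConnected_nodalDomain [Finite V] {G : MetricGraph V E} {R : ℝ}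
    (hR : ∀ g ∈ G.H1 univ, ∀ p q, (g p - g q) ^ 2 ≤ R * G.energy univ g g)
    {f : G.Point → ℝ} (hf : f ∈ G.H1 univ) {p q : G.Point} {c : ℝ} (hp : 0 < f p) (hq : f q < 0)
    (hfg : ∀ g ∈ G.H1 univ, G.energy univ f g = c * (g p - g q)) :
    IsConnected (closure {x | 0 < f x}) := by
  have hc := continuous_of_mem_H1 hf
  have hopen : IsOpen {x | 0 < f x} := isOpen_lt continuous_const hc
  set K := closure {x | 0 < f x} with hK
  have hsub : {x | 0 < f x} ⊆ K := subset_closure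
  have hqK : q ∉ K := fun h => absurd (nodalDomain_subset hc h) (not_le.2 hq)
  have key : ∀ C D : Set G.Point, IsClosed C → IsClosed D → K ⊆ C ∪ D → K ∩ (C ∩ D) = ∅ →
      p ∈ C → K ∩ D = ∅ := by
    intro C D hC hD hKCD hdis hpC
    set D' := K ∩ D with hD'
    have hD'c : IsClosed D' := isClosed_closure.inter hD
    have hCD' : ∀ x ∈ C, x ∉ D' := fun x hx hx' =>
      (eq_empty_iff_forall_notMem.1 hdis x) ⟨hx'.1, hx, hx'.2⟩
    have h0 : ∀ x ∈ frontier D', f x = 0 := by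
      intro x hx
      have hxD : x ∈ D' := hD'c.frontier_subset hx
      by_contra hne
      have hpos : 0 < f x := lt_of_le_of_ne (nodalDomain_subset hc hxD.1) (Ne.symm hne)
      -- A point of `D'` with `f > 0` would be interior to `D'`: nearby points stay in the nodal
      -- domain and outside `C`.
      refine hx.2 (mem_interior.2 ⟨{x | 0 < f x} ∩ Cᶜ, fun y hy => ?_,
        hopen.inter hC.isOpen_compl, hpos, fun hxC => hCD' x hxC hxD⟩)
      exact ⟨hsub hy.1, (hKCD (hsub hy.1)).resolve_left hy.2⟩
    have hψ := indicator_mem_H10 hf h0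
    have hψH := (extend_mem_H1 hD'c hψ).1
    have hψp : D'.indicator f p = 0 := indicator_of_notMem (hCD' p hpC) f
    have hψq : D'.indicator f q = 0 := indicator_of_notMem (fun h => hqK h.1) f
    have he : G.energy univ (D'.indicator f) (D'.indicator f) = 0 := by
      rw [← energy_eq_of_mem_H10 hD'c hψ hψ, energy_indicator_left hD'c hf hψ, hfg _ hψH, hψp, hψq]
      ring
    have hz : ∀ x, D'.indicator f x = 0 := fun x => by
      have := hR _ hψH x q
      rw [he, hψq, mul_zero, sub_zero] at this
      exact pow_eq_zero_iff two_ne_zero |>.1 (le_antisymm this (sq_nonneg _))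
    have hposC : {x | 0 < f x} ⊆ C := by
      intro x hx
      refine (hKCD (hsub hx)).resolve_right fun hxD => ?_
      have := hz x
      rw [indicator_of_mem (show x ∈ D' from ⟨hsub hx, hxD⟩)] at this
      exact absurd this (ne_of_gt hx)
    have hKC : K ⊆ C := closure_minimal hposC hC
    exact eq_empty_of_forall_notMem fun x hx => hCD' x (hKC hx.1) hx
  refine ⟨⟨p, hsub hp⟩, isPreconnected_closed_iff.2 fun C D hC hD hKCD hKC hKD => ?_⟩
  by_contra hcon
  rw [not_nonempty_iff_eq_empty] at hcon
  rcases hKCD (hsub hp) with h | h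
  · exact hKD.ne_empty (key C D hC hD hKCD hcon h)
  · exact hKC.ne_empty (key D C hD hC (by rwa [union_comm]) (by rwa [inter_comm D C]) h)

/-- Test functions supported in the nodal domain do not see the sink `q`, so there `q(f, g) = s * f
p * g p`. This is the eigenvalue equation for the point mass at `p`, with eigenvalue `s`. -/
theorem dirichletMin_nodalDomain_le [Finite V] {G : MetricGraph V E}
    {f : G.Point → ℝ} (hf : f ∈ G.H1 univ) {p q : G.Point} {s : ℝ≥0} (hp : 0 < f p) (hq : f q < 0)
    (hfg : ∀ g ∈ G.H1 univ, G.energy univ f g = s * f p * (g p - g q)) :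
    G.dirichletMin (closure {x | 0 < f x}) (frontier (closure {x | 0 < f x})) ≤ s := by
  have hc := continuous_of_mem_H1 hf
  have hopen : IsOpen {x | 0 < f x} := isOpen_lt continuous_const hc
  set K := closure {x | 0 < f x} with hK
  have hKc : IsClosed K := isClosed_closure
  have hint : {x | 0 < f x} ⊆ interior K := interior_maximal subset_closure hopen
  have hpK : p ∈ K := interior_subset (hint hp)
  have hpF : p ∉ frontier K := fun h => h.2 (hint hp)
  have hqK : q ∉ K := fun h => absurd (nodalDomain_subset hc h) (not_le.2 hq)
  have h0 : ∀ x ∈ frontier K, f x = 0 := fun x hx =>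
    le_antisymm (not_lt.1 fun h => hx.2 (hint h))
      (nodalDomain_subset hc (hKc.frontier_subset hx))
  have hF := indicator_mem_H10 hf h0
  have hFp : K.indicator f p = f p := indicator_of_mem hpK f
  have hen : ∀ g ∈ G.H10 K (frontier K), G.energy K (K.indicator f) g = s * f p * g p := by
    intro g hg
    rw [energy_indicator_left hKc hf hg, hfg g (extend_mem_H1 hKc hg).1, hg.1.2.1 q hqK, sub_zero]
  have hFc := continuous_of_mem_H1 (extend_mem_H1 hKc hF).1
  refine iInf₂_le_of_le (Measure.dirac p) ⟨inferInstance, ?_, ?_⟩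
    (eigenvalue_zero_le (f := K.indicator f) ⟨fun h => ?_, ⟨hF, fun g hg hg0 => ?_⟩,
      memLp_of_continuous (continuous_const.mul hFc) _, fun φ hφ => ?_⟩)
  · rw [Measure.dirac_apply' _ hKc.isOpen_compl.measurableSet]; simp [hpK]
  · rw [Measure.dirac_apply' _ isClosed_frontier.measurableSet]; simp [hpF]
  · rw [h] at hFp
    exact hp.ne hFp
  · have hps : p ∈ (Measure.dirac p).support :=
      mem_support_of_le (c := 1) one_ne_zero (by simp)
    -- For harmonicity, the test function vanishes on the frontier and at `p`, so the energy formula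
    -- `hen` gives zero.
    have hg' : g ∈ G.H10 K (frontier K) :=
      ⟨hg, fun x hx => hg0 x ⟨hKc.frontier_subset hx, fun h => h.2 (Or.inr hx)⟩⟩
    rw [hen g hg', hg0 p ⟨hpK, fun h => h.2 (Or.inl hps)⟩, mul_zero]
  · have hφc : Continuous fun x => s * K.indicator f x * φ x :=
      (continuous_const.mul hFc).mul (continuous_of_mem_H1 (extend_mem_H1 hKc hφ.1).1)
    rw [hen φ hφ.1, integral_dirac' _ _ hφc.stronglyMeasurable, hFp]

/-- An eigenfunction for the smallest possible eigenvalue has opposite extremal values, and it is a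
multiple of the potential of a flow between extremal points. -/
theorem IsEigenfunction.exists_flow [Finite V] {G : MetricGraph V E} {R : ℝ}
    (hR : ∀ g ∈ G.H1 univ, ∀ p q, (g p - g q) ^ 2 ≤ R * G.energy univ g g) (hR0 : 0 < R)
    {μ : Measure G.Point} [IsProbabilityMeasure μ] {f : G.Point → ℝ}
    (h : G.IsEigenfunction univ ∅ μ (4 / R) f) :
    ∃ p q, 0 < f p ∧ f q = -f p ∧
      ∀ g ∈ G.H1 univ, G.energy univ f g = 2 / R * f p * (g p - g q) := by
  have hf := h.mem_H1
  obtain ⟨p, q, hp, hq⟩ := exists_extremal_points (continuous_of_mem_H1 hf)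
  have hpq : f q < f p := by
    -- The eigenvalue is nonzero, so `f` has mean zero; if constant, it would vanish.
    refine lt_of_le_of_ne (hq p) fun heq => h.1 ?_
    have hconst : ∀ x, f x = f p := fun x => le_antisymm (hp x) (heq ▸ hq x)
    have h0 := (mul_eq_zero.1 h.mul_integral_eq_zero).resolve_left (by positivity)
    rw [integral_congr_ae (ae_of_all _ hconst), integral_const] at h0
    have h0 : f p = 0 := by simpa using h0
    exact funext fun x => (hconst x).trans h0
  obtain ⟨-, hle, -⟩ := h.extremal_values hR hR0.le hp hq hpq
  have hb := hR f hf p q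
  have hle' : R * G.energy univ f f ≤ 4 * -(f p * f q) := by
    have := mul_le_mul_of_nonneg_left hle hR0.le
    rwa [← mul_assoc, mul_div_cancel₀ _ hR0.ne'] at this
  -- The two bounds on `R q(f, f)` give `(f p - f q)² ≤ -4 f p f q`, that is, `(f p + f q)² ≤ 0`.
  have hsum : f q = -f p := by
    have h2 : (f p + f q) ^ 2 ≤ 0 := by linarith [hb.trans hle']
    have h3 := pow_eq_zero_iff two_ne_zero |>.1 (le_antisymm h2 (sq_nonneg _))
    linarith
  have hpos : 0 < f p := by linarith
  have heq : R * G.energy univ f f = (f p - f q) ^ 2 := by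
    refine le_antisymm (hle'.trans_eq ?_) hb
    rw [hsum]; ring
  refine ⟨p, q, hpos, hsum, fun g hg => ?_⟩
  -- By `hR`, the functional `(g p - g q)² - R q(g, g)` is nowhere positive, and it is zero at `f`;
  -- its first variation at `f` therefore vanishes.
  have hz : (f p - f q) * (g p - g q) - R * G.energy univ f g = 0 := by
    refine eq_zero_of_forall_two_mul_add_sq_mul_nonpos
      (b := (g p - g q) ^ 2 - R * G.energy univ g g) fun ε => ?_
    have := hR _ (add_mul_mem_H1 hf hg ε) p q
    rw [energy_add_mul_self hf hg] at this
    linarith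
  rw [hsum] at hz
  field_simp
  linarith

theorem exists_nodalPartition [Finite V] {G : MetricGraph V E} {R : ℝ}
    (hR : ∀ g ∈ G.H1 univ, ∀ p q, (g p - g q) ^ 2 ≤ R * G.energy univ g g) (hR0 : 0 < R)
    {μ : Measure G.Point} [IsProbabilityMeasure μ] {f : G.Point → ℝ}
    (h : G.IsEigenfunction univ ∅ μ (4 / R) f) :
    ∃ P : G.WeightedPartition 2,
      P.piece 0 = closure {x | 0 < f x} ∧ P.piece 1 = closure {x | f x < 0} ∧
      P.weight 0 = 1 / 2 ∧ P.weight 1 = 1 / 2 ∧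
      P.dirichletEnergy ≤ 4 / ENNReal.ofReal R := by
  have hf := h.mem_H1
  have hc := continuous_of_mem_H1 hf
  obtain ⟨p, q, hp, hq, hfg⟩ := h.exists_flow hR hR0
  have hnf : (fun x => -1 * f x) ∈ G.H1 univ := mul_mem_H1 hf (-1)
  have hneg : {x | 0 < -1 * f x} = {x | f x < 0} := by ext x; simp
  set s : ℝ≥0 := Real.toNNReal (2 / R) with hs
  have hsc : (s : ℝ) = 2 / R := Real.coe_toNNReal _ (by positivity)
  -- The function `-f` satisfies the same flow equation with source and sink exchanged, because `f q
  -- = -f p`.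
  have hngf : ∀ g ∈ G.H1 univ, G.energy univ (fun x => -1 * f x) g =
      s * (-1 * f q) * (g q - g p) := fun g hg => by
    rw [energy_mul_left hf hg, hfg g hg, hsc, hq]; ring
  have hq0 : 0 < -1 * f q := by rw [hq]; linarith
  have hp0 : -1 * f p < 0 := by linarith
  have hposc := isConnected_nodalDomain hR hf hp (by linarith : f q < 0) hfg
  have hnegc := isConnected_nodalDomain hR hnf hq0 hp0 hngf
  have hposd := dirichletMin_nodalDomain_le hf (s := s) hp (by linarith : f q < 0)
    (by rwa [hsc])
  have hnegd := dirichletMin_nodalDomain_le hnf hq0 hp0 hngf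
  rw [hneg] at hnegc hnegd
  have hdisj := disjoint_interior_nodalDomains hc
  refine ⟨⟨![closure {x | 0 < f x}, closure {x | f x < 0}], fun _ => 1 / 2, ?_, ?_, ?_,
    fun _ => by norm_num, by norm_num⟩, rfl, rfl, rfl, rfl, iSup_le fun i => ?_⟩
  · exact Fin.forall_fin_two.2 ⟨isClosed_closure, isClosed_closure⟩
  · exact Fin.forall_fin_two.2 ⟨hposc, hnegc⟩
  · refine Fin.forall_fin_two.2 ⟨Fin.forall_fin_two.2 ⟨fun h => absurd rfl h, fun _ => hdisj⟩,
      Fin.forall_fin_two.2 ⟨fun _ => hdisj.symm, fun h => absurd rfl h⟩⟩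
  · have hmul : ENNReal.ofReal (1 / (1 / 2)) * (s : ℝ≥0∞) = 4 / ENNReal.ofReal R := by
      rw [← ENNReal.ofReal_coe_nnreal, ← ENNReal.ofReal_mul (by norm_num), hsc,
        show 1 / (1 / 2) * (2 / R) = 4 / R by ring, ENNReal.ofReal_div_of_pos hR0]
      simp
    rw [← hmul]
    refine mul_le_mul_right ?_ _
    revert i
    exact Fin.forall_fin_two.2 ⟨hposd, hnegd⟩

end eigenvalue

end MetricGraph

end

/-! ### Proof of the theorem -/

theorem mainTheorem6 {V E : Type*} [Finite V] [Fintype E] (G : MetricGraph V E) :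
    G.minDirichletEnergy 2 = G.lambda1Min ∧
    (∃ μ : Measure G.Point, IsProbabilityMeasure μ ∧ G.lambda1 μ = G.lambda1Min) ∧
    ∀ μ : Measure G.Point, IsProbabilityMeasure μ → G.lambda1 μ = G.lambda1Min →
      ∀ (t : ℝ≥0) (f : G.Point → ℝ), (t : ℝ≥0∞) = G.lambda1 μ →
        G.IsEigenfunction Set.univ ∅ μ t f →
        ∃ P : G.WeightedPartition 2,
          P.piece 0 = closure {x | 0 < f x} ∧ P.piece 1 = closure {x | f x < 0} ∧
          P.weight 0 = 1 / 2 ∧ P.weight 1 = 1 / 2 ∧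
          P.dirichletEnergy = G.minDirichletEnergy 2 := by
  obtain ⟨x, y, k, hk, hkg, hR⟩ := G.exists_max_resistance
  have hR0 : 0 ≤ k x - k y := by rw [← hkg k hk]; exact G.energy_self_nonneg k
  have hlow : 4 / ENNReal.ofReal (k x - k y) ≤ G.lambda1Min :=
    le_iInf₂ fun μ hμ => MetricGraph.le_lambda1 hR hR0 μ
  have hlow' : 4 / ENNReal.ofReal (k x - k y) ≤ G.minDirichletEnergy 2 :=
    le_iInf fun P => MetricGraph.le_dirichletEnergy hR hR0 P
  -- If `R = 0`, every function in `H¹(G)` is constant. Then `4 / R = ∞`, so both sides are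
  -- infinite, any probability measure is optimal, and no eigenfunction has eigenvalue `λ₁`.
  rcases hR0.eq_or_lt with h0 | hpos
  · have htop : 4 / ENNReal.ofReal (k x - k y) = ⊤ := by
      rw [← h0, ENNReal.ofReal_zero, ENNReal.div_zero (by norm_num)]
    rw [htop, top_le_iff] at hlow hlow'
    have hdirac : G.lambda1Min ≤ G.lambda1 (Measure.dirac x) :=
      iInf₂_le (Measure.dirac x) Measure.dirac.isProbabilityMeasure
    refine ⟨hlow'.trans hlow.symm, ⟨Measure.dirac x, inferInstance, ?_⟩,
      fun μ _ hmin t f ht _ => ?_⟩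
    · rw [hlow, top_le_iff] at hdirac
      rw [hdirac, hlow]
    · rw [hmin, hlow] at ht
      exact absurd ht ENNReal.coe_ne_top
  · obtain ⟨μ, f, hμ, hf, hxy⟩ := MetricGraph.exists_isEigenfunction_of_potential hk hkg hpos
    have hcoe := MetricGraph.ofReal_four_div hpos
    have hreal : ((Real.toNNReal (4 / (k x - k y)) : ℝ≥0) : ℝ) = 4 / (k x - k y) :=
      Real.coe_toNNReal _ (by positivity)
    have hup : G.lambda1 μ ≤ 4 / ENNReal.ofReal (k x - k y) := by
      rw [← hcoe]
      exact MetricGraph.lambda1_le (by rwa [hreal]) hxy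
    have hmin : G.lambda1Min = 4 / ENNReal.ofReal (k x - k y) :=
      le_antisymm ((iInf₂_le μ hμ).trans hup) hlow
    have hL : G.minDirichletEnergy 2 = 4 / ENNReal.ofReal (k x - k y) := by
      -- The nodal partition of the centred potential attains the lower bound for partitions.
      obtain ⟨P, -, -, -, -, hP⟩ := MetricGraph.exists_nodalPartition hR hpos hf
      exact le_antisymm ((iInf_le _ P).trans hP) hlow'
    refine ⟨hL.trans hmin.symm, ⟨μ, hμ, le_antisymm (hmin ▸ hup) (iInf₂_le μ hμ)⟩,
      fun ν hν hνmin t g ht hg => ?_⟩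
    rw [hνmin, hmin, ← hcoe, ENNReal.coe_inj] at ht
    rw [ht, hreal] at hg
    obtain ⟨P, h0, h1, hw0, hw1, hP⟩ := MetricGraph.exists_nodalPartition hR hpos hg
    exact ⟨P, h0, h1, hw0, hw1, le_antisymm (hP.trans_eq hL.symm) (iInf_le _ P)⟩
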